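/- For every sample size $n$ let $\widehat\beta_C,\widehat\beta_E$ be estimators, $\widehat V_C,\widehat V_E$ estimators of their variances and $\widehat c$ an estimator of their covariance (real random variables on a probability space that may depend on $n$), and let $\beta_0,\beta_E$ be real parameters that may depend on $n$. Suppose that, with $\sigma_E^2<\sigma_C^2$, $$\sqrt n\begin{pmatrix}\widehat\beta_C-\beta_0\\ \widehat\beta_E-\beta_E\end{pmatrix}\stackrel{d}{\longrightarrow}\mathcal N\left(0,\begin{pmatrix}\sigma_C^2&\sigma_E^2\\ \sigma_E^2&\sigma_E^2\end{pmatrix}\right),\qquad n\widehat V_C\stackrel{p}{\longrightarrow}\sigma_C^2,\quad n\widehat V_E\stackrel{p}{\longrightarrow}\sigma_E^2,\quad n\widehat c\stackrel{p}{\longrightarrow}\sigma_E^2 .$$ For $\lambda\ge 0$ let $\widehat\beta_{MSE,\lambda}=\widehat p_\lambda\widehat\beta_E+(1-\widehat p_\lambda)\widehat\beta_C$, where $\widehat p_\lambda$ is a measurable minimizer over $p\in\mathbb R$ of $$p^2\max\left[0,(\widehat\beta_E-\widehat\beta_C)^2-\lambda\,(\widehat V_E+\widehat V_C-2\widehat c)\right]+p^2\widehat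 V_E+(1-p)^2\widehat V_C+2p(1-p)\widehat c$$ (with an arbitrary value on samples for which there is no minimizer). For $h\in\mathbb R$ let $(V,W_h)$ be a normal vector with means $(0,h)$, variances $(\sigma_C^2,\sigma_C^2-\sigma_E^2)$ and covariance $-(\sigma_C^2-\sigma_E^2)$, and let $$U_{h,\lambda}=V+W_h\,\frac{\sigma_C^2-\sigma_E^2}{\max\left[0,W_h^2-\lambda(\sigma_C^2-\sigma_E^2)\right]+\sigma_C^2-\sigma_E^2},$$ which is square-integrable for all $h\in\mathbb R$ and $\lambda\geq 0$. 1. If $\beta_0\ne\beta_E$ and $\beta_0,\beta_E$ do not depend on $n$, then $\sqrt n(\widehat\beta_{MSE,\lambda}-\beta_0)\stackrel{d}{\longrightarrow}\mathcal N(0,\sigma_C^2)$ for every $\lambda\geq 0$. 2. If $\beta_0=\beta_E$ for all $n$, then $\sqrt n(\widehat\beta_{MSE,\lambda}-\beta_0)\stackrel{d}{\longrightarrow}U_{0,\lambda}$ for every $\lambda\ge 0$. Moreover $E(U_{0,\lambda})=0$ for every $\lambda\geq 0$, the function $\lambda\mapsto V(U_{0,\lambda})$ (variance) is strictly decreasing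 on $[0,\infty)$, and $\lim_{\lambda\to+\infty}V(U_{0,\lambda})=\sigma_E^2$. 3. If $h\in\mathbb R$ and $\beta_E=\beta_0+h/\sqrt n$ for all $n\ge1$, then $\sqrt n(\widehat\beta_{MSE,\lambda}-\beta_0)\stackrel{d}{\longrightarrow}U_{h,\lambda}$ for every $\lambda\ge 0$. Moreover, for every $\lambda>0$, $$\max_{h\in\mathbb R}\left[E(U_{h,\lambda}^2)-E(U_{h,0}^2)\right]>\max_{h\in\mathbb R}\left[E(U_{h,0}^2)-E(U_{h,\lambda}^2)\right],$$ where both maxima are attained: the maximal regret of $\widehat\beta_{MSE,\lambda}$ relative to $\widehat\beta_{MSE}=\widehat\beta_{MSE,0}$ exceeds its maximal gain. -/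

import Mathlib

open MeasureTheory ProbabilityTheory Filter Topology

noncomputable section

namespace PretestMSE

/-- For every sample size `n`, the statistics computed from the sample (on a sample space `Ω n` that
may change with `n`): the consistent and the efficient estimators `bC`, `bE` of the parameter, the
estimators `vC`, `vE` of their variances and the estimator `cCE` of their covariance. -/
structure Statistics (Ω : ℕ → Type*) where
  bC : (n : ℕ) → Ω n → ℝ
  bE : (n : ℕ) → Ω n → ℝ
  vC : (n : ℕ) → Ω n → ℝ
  vE : (n : ℕ) → Ω n → ℝ
  cCE : (n : ℕ) → Ω n → ℝ

variable {Ω : ℕ → Type*}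

/-- The estimator of the variance of `bE - bC`. -/
def Statistics.vDiff (S : Statistics Ω) (n : ℕ) (ω : Ω n) : ℝ :=
  S.vE n ω + S.vC n ω - 2 * S.cCE n ω

/-- Convergence in probability to a constant, for random variables `X n` on probability spaces
`(Ω n, P n)` that may change with `n`. -/
def TendstoInProbConst [∀ n, MeasurableSpace (Ω n)] (P : (n : ℕ) → Measure (Ω n))
    (X : (n : ℕ) → Ω n → ℝ) (c : ℝ) : Prop :=
  ∀ ε : ℝ, 0 < ε → Tendsto (fun n ↦ P n {ω | ε ≤ |X n ω - c|}) atTop (𝓝 0)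

/-- The centred normal law on `ℝ²` with covariance matrix `[[σC², σE²], [σE², σE²]]`. -/
def jointLaw (σC σE : ℝ) : Measure (EuclideanSpace ℝ (Fin 2)) :=
  multivariateGaussian 0 !![σC ^ 2, σE ^ 2; σE ^ 2, σE ^ 2]

instance (σC σE : ℝ) : IsProbabilityMeasure (jointLaw σC σE) := by
  unfold jointLaw; infer_instance

/-- The set-up: `√n (bC - β₀, bE - β_E)` is asymptotically normal with the above law, and the
estimators of the variances and covariance, multiplied by `n`, are consistent for the asymptotic
ones. The true values `β₀`, `β_E` may depend on `n`. -/
structure Setup [∀ n, MeasurableSpace (Ω n)] (P : (n : ℕ) → Measure (Ω n))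
    [∀ n, IsProbabilityMeasure (P n)] (S : Statistics Ω) (β₀ βE : ℕ → ℝ) (σC σE : ℝ) : Prop where
  bC_aemeasurable : ∀ n, AEMeasurable (S.bC n) (P n)
  bE_aemeasurable : ∀ n, AEMeasurable (S.bE n) (P n)
  vC_aemeasurable : ∀ n, AEMeasurable (S.vC n) (P n)
  vE_aemeasurable : ∀ n, AEMeasurable (S.vE n) (P n)
  cCE_aemeasurable : ∀ n, AEMeasurable (S.cCE n) (P n)
  asymptotic_normality :
    TendstoInDistribution
      (fun (n : ℕ) (ω : Ω n) ↦
        (!₂[√(n : ℝ) * (S.bC n ω - β₀ n), √(n : ℝ) * (S.bE n ω - βE n)] :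
          EuclideanSpace ℝ (Fin 2)))
      atTop id P (jointLaw σC σE)
  variance_lt : σE ^ 2 < σC ^ 2
  vC_consistent : TendstoInProbConst P (fun n ω ↦ n * S.vC n ω) (σC ^ 2)
  vE_consistent : TendstoInProbConst P (fun n ω ↦ n * S.vE n ω) (σE ^ 2)
  cCE_consistent : TendstoInProbConst P (fun n ω ↦ n * S.cCE n ω) (σE ^ 2)

/-- The estimated mean-squared error of `p * bE + (1 - p) * bC`, where the squared bias of `bE` is
estimated by `max (0, (bE - bC)² - lam * vDiff)`. -/
def estimatedMSE (S : Statistics Ω) (lam : ℝ) (n : ℕ) (ω : Ω n) (p : ℝ) : ℝ :=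
  p ^ 2 * max 0 ((S.bE n ω - S.bC n ω) ^ 2 - lam * S.vDiff n ω)
    + p ^ 2 * S.vE n ω + (1 - p) ^ 2 * S.vC n ω + 2 * p * (1 - p) * S.cCE n ω

/-- `p` is a (measurable) minimizer over `ℝ` of the estimated mean-squared error. On samples where
that quadratic function of the weight has no minimizer, the value of `p` is arbitrary. -/
structure IsOptimalWeight [∀ n, MeasurableSpace (Ω n)] (P : (n : ℕ) → Measure (Ω n))
    (S : Statistics Ω) (lam : ℝ) (p : (n : ℕ) → Ω n → ℝ) : Prop where
  aemeasurable : ∀ n, AEMeasurable (p n) (P n)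
  isMin : ∀ n ω, (∃ q : ℝ, ∀ r : ℝ, estimatedMSE S lam n ω q ≤ estimatedMSE S lam n ω r) →
    ∀ r : ℝ, estimatedMSE S lam n ω (p n ω) ≤ estimatedMSE S lam n ω r

/-- The weighted sum of the two estimators, with weight `p` on the efficient one. -/
def combined (S : Statistics Ω) (p : (n : ℕ) → Ω n → ℝ) (n : ℕ) (ω : Ω n) : ℝ :=
  p n ω * S.bE n ω + (1 - p n ω) * S.bC n ω

/-- The law of the normal vector `(V, W_h)` with means `(0, h)`, variances `σC²` and `σC² - σE²`,
and covariance `-(σC² - σE²)`. -/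
def lawVW (σC σE h : ℝ) : Measure (EuclideanSpace ℝ (Fin 2)) :=
  multivariateGaussian !₂[0, h]
    !![σC ^ 2, -(σC ^ 2 - σE ^ 2); -(σC ^ 2 - σE ^ 2), σC ^ 2 - σE ^ 2]

instance (σC σE h : ℝ) : IsProbabilityMeasure (lawVW σC σE h) := by
  unfold lawVW; infer_instance

/-- The random variable
`U_{h,lam} = V + W_h (σC² - σE²) / (max (0, W_h² - lam (σC² - σE²)) + σC² - σE²)`,
as a function of the vector `x = (V, W_h)`; its law depends on `h` through `lawVW σC σE h`. -/
def limitU (σC σE lam : ℝ) (x : EuclideanSpace ℝ (Fin 2)) : ℝ :=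
  x 0 + x 1 * ((σC ^ 2 - σE ^ 2) /
    (max 0 (x 1 ^ 2 - lam * (σC ^ 2 - σE ^ 2)) + (σC ^ 2 - σE ^ 2)))

/-- The asymptotic quadratic risk `E(U_{h,lam}²)`. -/
def risk (σC σE h lam : ℝ) : ℝ :=
  ∫ x, limitU σC σE lam x ^ 2 ∂(lawVW σC σE h)

end PretestMSE

end

/-! The limit laws come from the closed form of the optimal weight. When the estimated variance of
the difference is positive, the criterion is a strictly convex quadratic in `p`. The normalized
combined estimator is then an explicit function of the normalized statistics and, under a fixed
alternative, of `1 / √n`. Truncating the denominator makes this function continuous without changing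
it on events of probability tending to one. Slutsky's theorem and continuous mapping conclude
(`tendsto_combined_local`, `tendsto_combined_fixed`).

For the risk, put `s = σC² - σE²`. The variable `V + W_h - h` is independent of `W_h`, with mean `0`
and variance `σE²`, so `E(U²) = σE² + s * shrinkRisk lam (h / √s)` (`risk_eq`). This is a
one-dimensional problem: estimating the mean error `x` of a unit normal observation `k + x` by `psi
lam (k + x)`. At `k = 0` the integrand `(w - psi lam w)²` decreases pointwise in `lam`, which gives
the claims on the variance.

For the regret, Stein's identity gives `shrinkRisk lam k - shrinkRisk 0 k = exp (-k²/2) * E[κ(w)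
cosh (k w)]`, with `κ = riskKernel lam` (`shrinkRisk_sub_eq`). As `w²` grows, `κ` changes sign once,
from negative to positive, and the Taylor remainders of `cosh` divided by `w²` increase with `w²`.
Hence `E[κ w²] ≥ 0` forces `κ` to have a nonnegative integral against every such remainder beyond
the constant term. The first remainder shows that the gain is largest at `k = 0`, where it equals
`-E κ > 0`. The remainder after four terms, at `k = √3`, bounds the regret there below by `exp
(-3/2) * (9/2)` times that gain, provided `E[κ L(w²)] > 0` for a cubic `L`; and `exp (3/2) < 9/2`.
The regret is continuous and vanishes at infinity, so its maximum is attained.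

The two moment inequalities remain, for all `lam > 0`. For small `lam` the moments are integrated in
the threshold, and each layer is compared with a rational Gaussian mean that is affine in Mills'
ratio at `1`. For large `lam` a square is completed in the Stein integrand. -/

noncomputable section

namespace PretestMSE

/-! ### Gaussian integrals of functions of exponential growth, and Stein's identity -/

/-- Measurable functions of at most exponential growth, which are integrable against Gaussian
measures. -/
structure ExpGrowth (F : ℝ → ℝ) : Prop where
  measurable : Measurable F
  bound : ∃ C a : ℝ, 0 ≤ C ∧ 0 ≤ a ∧ ∀ x, |F x| ≤ C * Real.exp (a * |x|)

namespace ExpGrowth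

variable {F G : ℝ → ℝ}

lemma const (c : ℝ) : ExpGrowth fun _ ↦ c :=
  ⟨measurable_const, |c|, 0, abs_nonneg c, le_rfl, by simp⟩

lemma id : ExpGrowth fun x ↦ x :=
  ⟨measurable_id, 1, 1, zero_le_one, zero_le_one, fun x ↦ by
    have := Real.add_one_le_exp |x|
    simp only [one_mul]
    linarith⟩

lemma mul (hF : ExpGrowth F) (hG : ExpGrowth G) : ExpGrowth fun x ↦ F x * G x := by
  obtain ⟨hFm, C, a, hC, ha, h⟩ := hF
  obtain ⟨hGm, D, b, hD, hb, h'⟩ := hG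
  refine ⟨hFm.mul hGm, C * D, a + b, mul_nonneg hC hD, add_nonneg ha hb, fun x ↦ ?_⟩
  rw [abs_mul, add_mul, Real.exp_add]
  calc |F x| * |G x| ≤ (C * Real.exp (a * |x|)) * (D * Real.exp (b * |x|)) :=
        mul_le_mul (h x) (h' x) (abs_nonneg _) (by positivity)
    _ = _ := by ring

lemma add (hF : ExpGrowth F) (hG : ExpGrowth G) : ExpGrowth fun x ↦ F x + G x := by
  obtain ⟨hFm, C, a, hC, ha, h⟩ := hF
  obtain ⟨hGm, D, b, hD, hb, h'⟩ := hG
  refine ⟨hFm.add hGm, C + D, a + b, add_nonneg hC hD, add_nonneg ha hb, fun x ↦ ?_⟩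
  have h1 : Real.exp (a * |x|) ≤ Real.exp ((a + b) * |x|) := by
    gcongr; linarith
  have h2 : Real.exp (b * |x|) ≤ Real.exp ((a + b) * |x|) := by
    gcongr; linarith
  calc |F x + G x| ≤ |F x| + |G x| := abs_add_le _ _
    _ ≤ C * Real.exp (a * |x|) + D * Real.exp (b * |x|) := add_le_add (h x) (h' x)
    _ ≤ C * Real.exp ((a + b) * |x|) + D * Real.exp ((a + b) * |x|) := by gcongr
    _ = _ := by ring

lemma const_mul (c : ℝ) (hF : ExpGrowth F) : ExpGrowth fun x ↦ c * F x := (const c).mul hF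

lemma neg (hF : ExpGrowth F) : ExpGrowth fun x ↦ -F x := by
  simpa using hF.const_mul (-1)

lemma sub (hF : ExpGrowth F) (hG : ExpGrowth G) : ExpGrowth fun x ↦ F x - G x := by
  simpa [sub_eq_add_neg] using hF.add hG.neg

lemma pow (hF : ExpGrowth F) (n : ℕ) : ExpGrowth fun x ↦ F x ^ n := by
  induction n with
  | zero => simpa using const 1
  | succ n ih => simpa [pow_succ] using ih.mul hF

lemma mono (hG : ExpGrowth G) (hF : Measurable F) (h : ∀ x, |F x| ≤ |G x|) : ExpGrowth F := by
  obtain ⟨-, C, a, hC, ha, h'⟩ := hG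
  exact ⟨hF, C, a, hC, ha, fun x ↦ (h x).trans (h' x)⟩

lemma of_bounded (hF : Measurable F) (C : ℝ) (h : ∀ x, |F x| ≤ C) : ExpGrowth F :=
  (const C).mono hF fun x ↦ (h x).trans (le_abs_self C)

lemma indicator (hF : ExpGrowth F) {s : Set ℝ} (hs : MeasurableSet s) :
    ExpGrowth (s.indicator F) :=
  hF.mono (hF.measurable.indicator hs) fun x ↦ by
    by_cases hx : x ∈ s <;> simp [hx]

lemma exp_mul (k : ℝ) : ExpGrowth fun x ↦ Real.exp (k * x) :=
  ⟨by fun_prop, 1, |k|, zero_le_one, abs_nonneg k, fun x ↦ by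
    rw [abs_of_pos (Real.exp_pos _), one_mul, ← abs_mul]
    exact Real.exp_le_exp.2 (le_abs_self _)⟩

lemma comp_const_add (hF : ExpGrowth F) (k : ℝ) : ExpGrowth fun x ↦ F (k + x) := by
  obtain ⟨hFm, C, a, hC, ha, h⟩ := hF
  refine ⟨by fun_prop, C * Real.exp (a * |k|), a, by positivity, ha, fun x ↦ (h _).trans ?_⟩
  rw [mul_assoc, ← Real.exp_add, ← mul_add]
  gcongr
  exact abs_add_le k x

lemma integrable (hF : ExpGrowth F) : Integrable F (gaussianReal 0 1) := by
  obtain ⟨hFm, C, a, hC, ha, h⟩ := hF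
  have h1 : Integrable (fun x ↦ C * (Real.exp (a * x) + Real.exp (-a * x))) (gaussianReal 0 1) :=
    ((integrable_exp_mul_gaussianReal a).add (integrable_exp_mul_gaussianReal (-a))).const_mul C
  refine h1.mono' hFm.aestronglyMeasurable (ae_of_all _ fun x ↦ (h x).trans ?_)
  gcongr
  rcases abs_cases x with ⟨hx, -⟩ | ⟨hx, -⟩ <;> rw [hx]
  · linarith [Real.exp_pos (-a * x)]
  · rw [mul_neg, ← neg_mul]; linarith [Real.exp_pos (a * x)]

lemma integrable_pdf (hF : ExpGrowth F) :
    Integrable fun x ↦ gaussianPDFReal 0 1 x * F x := by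
  have h := hF.integrable
  rw [gaussianReal_of_var_ne_zero _ one_ne_zero, integrable_withDensity_iff_integrable_smul'
    (measurable_gaussianPDF _ _) (ae_of_all _ fun _ ↦ gaussianPDF_lt_top)] at h
  simpa [toReal_gaussianPDF] using h

end ExpGrowth

lemma integral_gaussian_eq (F : ℝ → ℝ) :
    ∫ x, F x ∂(gaussianReal 0 1) = ∫ x, gaussianPDFReal 0 1 x * F x := by
  simp [integral_gaussianReal_eq_integral_smul one_ne_zero]

lemma gaussianPDFReal_zero_one (x : ℝ) :
    gaussianPDFReal 0 1 x = (√(2 * Real.pi))⁻¹ * Real.exp (-x ^ 2 / 2) := by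
  simp [gaussianPDFReal]

lemma hasDerivAt_gaussianPDFReal (x : ℝ) :
    HasDerivAt (gaussianPDFReal 0 1) (-x * gaussianPDFReal 0 1 x) x := by
  have h : HasDerivAt (fun y : ℝ ↦ (√(2 * Real.pi))⁻¹ * Real.exp (-y ^ 2 / 2))
      ((√(2 * Real.pi))⁻¹ * (Real.exp (-x ^ 2 / 2) * (-(2 * x) / 2))) x := by
    have := ((((hasDerivAt_id x).pow 2).neg.div_const 2).exp).const_mul ((√(2 * Real.pi))⁻¹)
    simpa using this
  rw [show gaussianPDFReal 0 1 = fun y : ℝ ↦ (√(2 * Real.pi))⁻¹ * Real.exp (-y ^ 2 / 2) from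
    funext gaussianPDFReal_zero_one]
  convert h using 1
  ring

/-- Since `a |x| ≤ a² + x² / 4`, half of the Gaussian exponent absorbs the growth. It makes the
boundary terms in Stein's identity vanish. -/
lemma ExpGrowth.tendsto_pdf_mul {F : ℝ → ℝ} (hF : ExpGrowth F) {l : Filter ℝ}
    (hl : Tendsto (fun x : ℝ ↦ x ^ 2) l atTop) :
    Tendsto (fun x ↦ F x * gaussianPDFReal 0 1 x) l (𝓝 0) := by
  obtain ⟨hFm, C, a, hC, ha, h⟩ := hF
  have h1 : Tendsto (fun x : ℝ ↦ C * Real.exp (a ^ 2) * (√(2 * Real.pi))⁻¹ *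
      Real.exp (-(x ^ 2 / 4))) l (𝓝 (C * Real.exp (a ^ 2) * (√(2 * Real.pi))⁻¹ * 0)) :=
    (Real.tendsto_exp_neg_atTop_nhds_zero.comp (hl.atTop_div_const (by norm_num))).const_mul _
  rw [mul_zero] at h1
  refine squeeze_zero_norm (fun x ↦ ?_) h1
  rw [Real.norm_eq_abs, abs_mul, abs_of_nonneg (gaussianPDFReal_nonneg _ _ _),
    gaussianPDFReal_zero_one]
  have h2 : Real.exp (a * |x|) * Real.exp (-x ^ 2 / 2) ≤
      Real.exp (a ^ 2) * Real.exp (-(x ^ 2 / 4)) := by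
    rw [← Real.exp_add, ← Real.exp_add, Real.exp_le_exp]
    nlinarith [sq_nonneg (a - |x| / 2), sq_abs x]
  calc |F x| * ((√(2 * Real.pi))⁻¹ * Real.exp (-x ^ 2 / 2))
      ≤ (C * Real.exp (a * |x|)) * ((√(2 * Real.pi))⁻¹ * Real.exp (-x ^ 2 / 2)) := by
        gcongr; exact h x
    _ = C * (√(2 * Real.pi))⁻¹ * (Real.exp (a * |x|) * Real.exp (-x ^ 2 / 2)) := by ring
    _ ≤ C * (√(2 * Real.pi))⁻¹ * (Real.exp (a ^ 2) * Real.exp (-(x ^ 2 / 4))) := by gcongr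
    _ = _ := by ring

/-- **Stein's identity** for the standard normal law, for continuous functions that are
differentiable off a countable set. -/
lemma stein {F F' : ℝ → ℝ} {s : Set ℝ} (hs : s.Countable) (hc : Continuous F)
    (hd : ∀ x, x ∉ s → HasDerivAt F (F' x) x) (hF : ExpGrowth F) (hF' : ExpGrowth F') :
    ∫ x, F' x ∂(gaussianReal 0 1) = ∫ x, x * F x ∂(gaussianReal 0 1) := by
  have hxF : ExpGrowth fun x ↦ x * F x := ExpGrowth.id.mul hF
  have hi := (hF'.sub hxF).integrable_pdf
  have h1 := intervalIntegral_tendsto_integral hi tendsto_neg_atTop_atBot tendsto_id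
  have hpc : Continuous (gaussianPDFReal 0 1) :=
    continuous_iff_continuousAt.2 fun x ↦ (hasDerivAt_gaussianPDFReal x).continuousAt
  -- As the density satisfies `φ' = -x φ`, the derivative of `F φ` is `φ (F' - x F)`; the
  -- fundamental theorem of calculus tolerates the countable exceptional set.
  have h2 (R : ℝ) : ∫ x in (-R)..(_root_.id R), gaussianPDFReal 0 1 x * (F' x - x * F x) =
      F R * gaussianPDFReal 0 1 R - F (-R) * gaussianPDFReal 0 1 (-R) := by
    refine integral_eq_of_hasDerivAt_off_countable (fun x ↦ F x * gaussianPDFReal 0 1 x) _ hs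
      (hc.mul hpc).continuousOn (fun x hx ↦ ?_) hi.intervalIntegrable
    exact ((hd x hx.2).fun_mul (hasDerivAt_gaussianPDFReal x)).congr_deriv (by ring)
  simp_rw [h2] at h1
  have hsq : Tendsto (fun x : ℝ ↦ x ^ 2) atTop atTop := tendsto_pow_atTop two_ne_zero
  have h3 := (hF.tendsto_pdf_mul hsq).sub ((hF.tendsto_pdf_mul (l := atBot)
    (by simpa [Function.comp_def] using hsq.comp tendsto_neg_atBot_atTop)).comp
      tendsto_neg_atTop_atBot)
  have h4 := tendsto_nhds_unique h1 h3
  rw [← integral_gaussian_eq, integral_sub hF'.integrable hxF.integrable] at h4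
  linarith

/-! ### The shrinkage functions and the risk kernel -/

/-- The shrinkage function: with `w` the normalized difference of the estimators, `psi lam w` is the
optimal weight times `w`. -/
def psi (lam w : ℝ) : ℝ := w / (1 + max 0 (w ^ 2 - lam))

/-- The derivative of `psi lam`, off the points where `w ^ 2 = lam`. -/
def dpsi (lam w : ℝ) : ℝ :=
  if w ^ 2 < lam then 1 else (1 - lam - w ^ 2) / (1 + w ^ 2 - lam) ^ 2

/-- The unbiased estimator of the difference of the risks, as given by Stein's identity. -/
def riskKernel (lam w : ℝ) : ℝ :=
  psi lam w ^ 2 - psi 0 w ^ 2 - 2 * (dpsi lam w - dpsi 0 w)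

/-- The quadratic risk of the shrinkage function `psi lam` at the mean `k`. -/
def shrinkRisk (lam k : ℝ) : ℝ := ∫ x, (x - psi lam (k + x)) ^ 2 ∂(gaussianReal 0 1)

lemma psi_den_pos (lam w : ℝ) : 0 < 1 + max 0 (w ^ 2 - lam) := by positivity

lemma psi_of_le {lam w : ℝ} (h : w ^ 2 ≤ lam) : psi lam w = w := by
  simp [psi, max_eq_left (sub_nonpos.2 h)]

lemma psi_of_ge {lam w : ℝ} (h : lam ≤ w ^ 2) : psi lam w = w / (1 + w ^ 2 - lam) := by
  rw [psi, max_eq_right (sub_nonneg.2 h), add_sub_assoc]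

lemma psi_zero_left (w : ℝ) : psi 0 w = w / (1 + w ^ 2) := by
  rw [psi_of_ge (sq_nonneg w), sub_zero]

lemma psi_neg (lam w : ℝ) : psi lam (-w) = -psi lam w := by
  simp [psi, neg_div]

lemma continuous_psi (lam : ℝ) : Continuous (psi lam) := by
  unfold psi
  exact continuous_id.div (by fun_prop) fun w ↦ (psi_den_pos lam w).ne'

@[fun_prop]
lemma measurable_psi (lam : ℝ) : Measurable (psi lam) := (continuous_psi lam).measurable

lemma one_add_sq_le {lam : ℝ} (hlam : 0 ≤ lam) (w : ℝ) :
    1 + w ^ 2 ≤ (1 + lam) * (1 + max 0 (w ^ 2 - lam)) := by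
  have h1 := le_max_right 0 (w ^ 2 - lam)
  have h2 := mul_nonneg hlam (le_max_left 0 (w ^ 2 - lam))
  linarith

/-- The decay of order `1 / |w|` gives both the uniform bound and the vanishing of the regret at
infinity. -/
lemma abs_psi_le {lam : ℝ} (hlam : 0 ≤ lam) (w : ℝ) :
    |psi lam w| ≤ (1 + lam) * |w| / (1 + w ^ 2) := by
  rw [psi, abs_div, abs_of_pos (psi_den_pos lam w), div_le_div_iff₀ (psi_den_pos lam w)
    (by positivity)]
  nlinarith [mul_le_mul_of_nonneg_left (one_add_sq_le hlam w) (abs_nonneg w)]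

lemma abs_psi_le' {lam : ℝ} (hlam : 0 ≤ lam) (w : ℝ) : |psi lam w| ≤ 1 + lam := by
  refine (abs_psi_le hlam w).trans ?_
  rw [div_le_iff₀ (by positivity)]
  gcongr
  nlinarith [sq_abs w, sq_nonneg (|w| - 1)]

lemma abs_psi_le_abs (lam w : ℝ) : |psi lam w| ≤ |w| := by
  rw [psi, abs_div, abs_of_pos (psi_den_pos lam w)]
  exact div_le_self (abs_nonneg w) (by linarith [le_max_left 0 (w ^ 2 - lam)])

lemma ExpGrowth.psi {lam : ℝ} : ExpGrowth (psi lam) :=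
  ExpGrowth.id.mono (measurable_psi lam) (abs_psi_le_abs lam)

lemma dpsi_zero_left (w : ℝ) : dpsi 0 w = (1 - w ^ 2) / (1 + w ^ 2) ^ 2 := by
  simp [dpsi, not_lt.2 (sq_nonneg w)]

lemma measurable_dpsi (lam : ℝ) : Measurable (dpsi lam) :=
  Measurable.ite (measurableSet_lt (by fun_prop) measurable_const) measurable_const (by fun_prop)

lemma ExpGrowth.dpsi {lam : ℝ} (hlam : 0 ≤ lam) : ExpGrowth (dpsi lam) := by
  refine .of_bounded (measurable_dpsi lam) ((1 + lam) ^ 2) fun w ↦ ?_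
  by_cases h : w ^ 2 < lam
  · simp only [PretestMSE.dpsi, if_pos h, abs_one]
    nlinarith
  · have h1 := one_add_sq_le hlam w
    rw [max_eq_right (by linarith : (0 : ℝ) ≤ w ^ 2 - lam)] at h1
    have h2 : 1 ≤ 1 + w ^ 2 - lam := by linarith
    rw [PretestMSE.dpsi, if_neg h, abs_div, abs_of_pos (by positivity : 0 < (1 + w ^ 2 - lam) ^ 2),
      div_le_iff₀ (by positivity), abs_le]
    have h3 : 1 + w ^ 2 ≤ (1 + lam) * (1 + w ^ 2 - lam) := by linarith
    have h4 : (1 + lam) * (1 + w ^ 2) ≤ (1 + lam) ^ 2 * (1 + w ^ 2 - lam) := by nlinarith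
    have h5 : (1 + lam) ^ 2 * (1 + w ^ 2 - lam) ≤ (1 + lam) ^ 2 * (1 + w ^ 2 - lam) ^ 2 := by
      gcongr; nlinarith
    constructor <;> nlinarith [sq_nonneg w, mul_nonneg hlam (sq_nonneg w)]

lemma hasDerivAt_psi {lam w : ℝ} (h : w ^ 2 ≠ lam) : HasDerivAt (psi lam) (dpsi lam w) w := by
  rcases lt_or_gt_of_ne h with h | h
  · rw [dpsi, if_pos h]
    refine (hasDerivAt_id w).congr_of_eventuallyEq ?_
    filter_upwards [(continuous_pow 2).continuousAt.eventually_lt_const h] with x hx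
    exact psi_of_le hx.le
  · rw [dpsi, if_neg h.le.not_gt]
    have hne : 1 + w ^ 2 - lam ≠ 0 := by linarith
    have h1 : HasDerivAt (fun x : ℝ ↦ x / (1 + x ^ 2 - lam))
        ((1 * (1 + w ^ 2 - lam) - w * (2 * w)) / (1 + w ^ 2 - lam) ^ 2) w := by
      refine (hasDerivAt_id w).fun_div ?_ hne
      simpa using ((hasDerivAt_pow 2 w).const_add 1).sub_const lam
    refine (h1.congr_deriv (by ring)).congr_of_eventuallyEq ?_
    filter_upwards [(continuous_pow 2).continuousAt.eventually_const_lt h] with x hx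
    exact psi_of_ge hx.le

lemma countable_sq_eq (lam : ℝ) : {w : ℝ | w ^ 2 = lam}.Countable := by
  refine Set.Finite.countable (Set.Finite.subset (Set.toFinite {√lam, -√lam}) fun w hw ↦ ?_)
  have hw : w ^ 2 = lam := hw
  rw [Set.mem_insert_iff, Set.mem_singleton_iff, ← hw, Real.sqrt_sq_eq_abs]
  rcases abs_cases w with ⟨h, -⟩ | ⟨h, -⟩ <;> rw [h] <;> simp

lemma ExpGrowth.riskKernel {lam : ℝ} (hlam : 0 ≤ lam) : ExpGrowth (riskKernel lam) :=
  ((ExpGrowth.psi.pow 2).sub (ExpGrowth.psi.pow 2)).sub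
    (((ExpGrowth.dpsi hlam).sub (ExpGrowth.dpsi le_rfl)).const_mul 2)

lemma riskKernel_neg (lam w : ℝ) : riskKernel lam (-w) = riskKernel lam w := by
  simp [riskKernel, psi_neg, dpsi]

/-- Stein's identity for the risk kernel against a smooth weight. -/
lemma integral_riskKernel_mul {lam : ℝ} (hlam : 0 ≤ lam) {g g' : ℝ → ℝ}
    (hd : ∀ x, HasDerivAt g (g' x) x) (hg : ExpGrowth g) (hg' : ExpGrowth g') :
    ∫ w, riskKernel lam w * g w ∂(gaussianReal 0 1) =
      ∫ w, ((psi lam w ^ 2 * g w + 2 * psi lam w * (g' w - w * g w)) -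
        (psi 0 w ^ 2 * g w + 2 * psi 0 w * (g' w - w * g w))) ∂(gaussianReal 0 1) := by
  have hδ : ExpGrowth fun w ↦ psi lam w - psi 0 w := ExpGrowth.psi.sub ExpGrowth.psi
  have hδ' : ExpGrowth fun w ↦ dpsi lam w - dpsi 0 w :=
    (ExpGrowth.dpsi hlam).sub (ExpGrowth.dpsi le_rfl)
  have hF := hδ.mul hg
  have hF' := (hδ'.mul hg).add (hδ.mul hg')
  have hgc : Continuous g := continuous_iff_continuousAt.2 fun x ↦ (hd x).continuousAt
  -- Stein's identity for `(psi lam - psi 0) * g` removes the derivatives `dpsi` from the kernel.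
  have key := stein (F := fun w ↦ (psi lam w - psi 0 w) * g w)
    ((countable_sq_eq lam).union (countable_sq_eq 0))
    (((continuous_psi lam).sub (continuous_psi 0)).mul hgc) (fun x hx ↦ by
      simp only [Set.mem_union, Set.mem_ofPred_eq, not_or] at hx
      exact ((hasDerivAt_psi hx.1).fun_sub (hasDerivAt_psi hx.2)).fun_mul (hd x)) hF hF'
  have h1 : ∫ w, riskKernel lam w * g w ∂(gaussianReal 0 1) =
      ∫ w, ((psi lam w ^ 2 - psi 0 w ^ 2) * g w + 2 * ((psi lam w - psi 0 w) * g' w)) -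
        2 * ((dpsi lam w - dpsi 0 w) * g w + (psi lam w - psi 0 w) * g' w)
          ∂(gaussianReal 0 1) := by
    congr 1 with w; unfold riskKernel; ring
  have hA : ExpGrowth fun w ↦
      (psi lam w ^ 2 - psi 0 w ^ 2) * g w + 2 * ((psi lam w - psi 0 w) * g' w) :=
    (((ExpGrowth.psi.pow 2).sub (ExpGrowth.psi.pow 2)).mul hg).add ((hδ.mul hg').const_mul 2)
  rw [h1, integral_sub hA.integrable (hF'.const_mul 2).integrable, integral_const_mul, key,
    ← integral_const_mul, ← integral_sub hA.integrable
      ((ExpGrowth.id.mul hF).const_mul 2).integrable]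
  congr 1 with w
  ring

/-- Exponential tilting: `φ (w - k) = φ w * exp (k w - k² / 2)`. -/
lemma integral_gaussian_shift (k : ℝ) (F : ℝ → ℝ) :
    ∫ x, F x ∂(gaussianReal 0 1) =
      ∫ w, F (w - k) * Real.exp (k * w - k ^ 2 / 2) ∂(gaussianReal 0 1) := by
  rw [integral_gaussian_eq, integral_gaussian_eq, ← integral_sub_right_eq_self _ k]
  congr 1 with w
  have : Real.exp (-(w - k) ^ 2 / 2) =
      Real.exp (-w ^ 2 / 2) * Real.exp (k * w - k ^ 2 / 2) := by
    rw [← Real.exp_add]; congr 1; ring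
  rw [gaussianPDFReal_zero_one, gaussianPDFReal_zero_one, this]
  ring

lemma integral_gaussian_neg (F : ℝ → ℝ) :
    ∫ x, F (-x) ∂(gaussianReal 0 1) = ∫ x, F x ∂(gaussianReal 0 1) := by
  rw [integral_gaussian_eq, integral_gaussian_eq, ← integral_neg_eq_self]
  simp [gaussianPDFReal_zero_one]

lemma ExpGrowth.shrinkRisk (lam k : ℝ) : ExpGrowth fun x ↦ (x - PretestMSE.psi lam (k + x)) ^ 2 :=
  (ExpGrowth.id.sub (ExpGrowth.psi.comp_const_add k)).pow 2

lemma shrinkRisk_sub (lam k : ℝ) :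
    shrinkRisk lam k - shrinkRisk 0 k = ∫ x, (psi lam (k + x) - psi 0 (k + x)) *
      (psi lam (k + x) + psi 0 (k + x) - 2 * x) ∂(gaussianReal 0 1) := by
  rw [shrinkRisk, shrinkRisk, ← integral_sub (ExpGrowth.shrinkRisk lam k).integrable
    (ExpGrowth.shrinkRisk 0 k).integrable]
  congr 1 with x
  ring

/-- The difference of the risks is the mean of the risk kernel. -/
lemma shrinkRisk_sub_eq {lam : ℝ} (hlam : 0 ≤ lam) (k : ℝ) :
    shrinkRisk lam k - shrinkRisk 0 k = Real.exp (-k ^ 2 / 2) *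
      ∫ w, riskKernel lam w * Real.cosh (k * w) ∂(gaussianReal 0 1) := by
  have hg : ExpGrowth fun w ↦ Real.exp (k * w) := .exp_mul k
  have hd (x : ℝ) : HasDerivAt (fun w ↦ Real.exp (k * w)) (k * Real.exp (k * x)) x := by
    have := ((hasDerivAt_id x).const_mul k).exp
    simpa [mul_comm] using this
  -- For the weight `exp (k w)` the Stein integrand has the factor `ψ² + 2 ψ (k - w) = (w - k - ψ)²
  -- - (w - k)²`, so the difference of two of them is a difference of squared errors. Evenness of
  -- the kernel then replaces `exp` by `cosh`.
  have h1 := integral_riskKernel_mul hlam hd hg (hg.const_mul k)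
  have h2 : ∫ w, riskKernel lam w * Real.exp (k * w) ∂(gaussianReal 0 1) =
      ∫ w, riskKernel lam w * Real.exp (-k * w) ∂(gaussianReal 0 1) := by
    rw [← integral_gaussian_neg]
    simp [riskKernel_neg]
  have hi := ((ExpGrowth.riskKernel hlam).mul hg).integrable
  have hi' := ((ExpGrowth.riskKernel hlam).mul (.exp_mul (-k))).integrable
  have h3 : ∫ w, riskKernel lam w * Real.cosh (k * w) ∂(gaussianReal 0 1) =
      ∫ w, riskKernel lam w * Real.exp (k * w) ∂(gaussianReal 0 1) := by
    have : ∀ w, riskKernel lam w * Real.cosh (k * w) = 2⁻¹ * (riskKernel lam w * Real.exp (k * w)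
        + riskKernel lam w * Real.exp (-k * w)) := fun w ↦ by
      rw [Real.cosh_eq, neg_mul]; ring
    simp_rw [this]
    rw [integral_const_mul, integral_add hi hi', ← h2]
    ring
  rw [h3, h1, shrinkRisk_sub, integral_gaussian_shift k, ← integral_const_mul]
  congr 1 with w
  rw [show k * w - k ^ 2 / 2 = -k ^ 2 / 2 + k * w by ring, Real.exp_add,
    add_sub_cancel]
  ring

/-! ### The single sign change of the risk kernel -/

lemma riskKernel_of_lt {lam w : ℝ} (h : w ^ 2 < lam) :
    riskKernel lam w = w ^ 2 * ((w ^ 2) ^ 2 - 6) / (1 + w ^ 2) ^ 2 := by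
  have : 1 + w ^ 2 ≠ 0 := by positivity
  rw [riskKernel, psi_of_le h.le, psi_zero_left, dpsi, if_pos h, dpsi_zero_left]
  field_simp
  ring

lemma riskKernel_of_ge {lam w : ℝ} (h : lam ≤ w ^ 2) :
    riskKernel lam w = lam * (8 * (w ^ 2) ^ 2 + (6 - 3 * lam) * w ^ 2 - 2 * (1 - lam)) /
      ((1 + w ^ 2) ^ 2 * (1 + w ^ 2 - lam) ^ 2) := by
  have h1 : 1 + w ^ 2 ≠ 0 := by positivity
  have h2 : 1 + w ^ 2 - lam ≠ 0 := by linarith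
  rw [riskKernel, psi_of_ge h, psi_zero_left, dpsi, if_neg h.not_gt, dpsi_zero_left]
  field_simp
  ring

/-- The risk kernel changes sign once as `w ^ 2` increases, from negative to positive. -/
lemma exists_sign_change {lam : ℝ} (hlam : 0 < lam) :
    ∃ t : ℝ, 0 < t ∧ ∀ w, (w ^ 2 ≤ t → riskKernel lam w ≤ 0 ∨ w ^ 2 = t) ∧
      (t < w ^ 2 → 0 ≤ riskKernel lam w) := by
  have hlt {w : ℝ} (h : w ^ 2 < lam) (h' : (w ^ 2) ^ 2 ≤ 6) : riskKernel lam w ≤ 0 := by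
    rw [riskKernel_of_lt h]
    exact div_nonpos_of_nonpos_of_nonneg
      (mul_nonpos_of_nonneg_of_nonpos (sq_nonneg w) (by linarith)) (by positivity)
  have hge {w : ℝ} (h : lam ≤ w ^ 2)
      (h' : 0 ≤ 8 * (w ^ 2) ^ 2 + (6 - 3 * lam) * w ^ 2 - 2 * (1 - lam)) :
      0 ≤ riskKernel lam w := by
    rw [riskKernel_of_ge h]
    have : 0 ≤ lam * (8 * (w ^ 2) ^ 2 + (6 - 3 * lam) * w ^ 2 - 2 * (1 - lam)) :=
      mul_nonneg hlam.le h'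
    positivity
  have hge' {w : ℝ} (h : lam ≤ w ^ 2)
      (h' : 8 * (w ^ 2) ^ 2 + (6 - 3 * lam) * w ^ 2 - 2 * (1 - lam) ≤ 0) :
      riskKernel lam w ≤ 0 := by
    rw [riskKernel_of_ge h]
    exact div_nonpos_of_nonpos_of_nonneg (mul_nonpos_of_nonneg_of_nonpos hlam.le h')
      (by positivity)
  -- Below the threshold the kernel has the sign of `w⁴ - 6`, above it that of a quadratic in `w²`
  -- whose value at `lam` is `5 lam² + 8 lam - 2`. So the change occurs at `√6`, at the threshold
  -- itself, or at a root of the quadratic.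
  rcases lt_or_ge (lam ^ 2) 6 with h6 | h6
  · rcases le_or_gt 0 (5 * lam ^ 2 + 8 * lam - 2) with h0 | h0
    -- The kernel jumps at `w² = lam` and is already nonnegative there, which is why the point `w² =
    -- t` is exempted.
    · refine ⟨lam, hlam, fun w ↦ ⟨fun h ↦ ?_, fun h ↦ hge h.le ?_⟩⟩
      · rcases h.lt_or_eq with h | h
        · exact .inl (hlt h (by nlinarith [sq_nonneg w]))
        · exact .inr h
      · nlinarith
    · have h1 : lam < 1 := by nlinarith
      -- The quadratic is negative at `lam` and equals `12 - lam > 0` at `1`.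
      obtain ⟨t, ⟨ht1, ht2⟩, ht⟩ := intermediate_value_Icc h1.le
        (f := fun s : ℝ ↦ 8 * s ^ 2 + (6 - 3 * lam) * s - 2 * (1 - lam))
        (by fun_prop) (show (0 : ℝ) ∈ _ from ⟨by nlinarith, by nlinarith⟩)
      simp only at ht
      refine ⟨t, hlam.trans_le ht1, fun w ↦ ⟨fun h ↦ .inl ?_, fun h ↦ hge (ht1.trans h.le) ?_⟩⟩
      · rcases lt_or_ge (w ^ 2) lam with hw | hw
        · exact hlt hw (by nlinarith [sq_nonneg w])
        · exact hge' hw (by nlinarith)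
      · nlinarith
  · have h6' : (√6) ^ 2 = (6 : ℝ) := Real.sq_sqrt (by norm_num)
    have h60 : 0 < √(6 : ℝ) := by positivity
    have hl : √6 ≤ lam := by
      rw [Real.sqrt_le_left hlam.le]; exact h6
    refine ⟨√6, h60, fun w ↦ ⟨fun h ↦ ?_, fun h ↦ ?_⟩⟩
    · rcases h.lt_or_eq with h | h
      · exact .inl (hlt (h.trans_le hl) (by nlinarith [sq_nonneg w]))
      · exact .inr h
    · rcases lt_or_ge (w ^ 2) lam with hw | hw
      · rw [riskKernel_of_lt hw]
        have : 0 ≤ (w ^ 2) ^ 2 - 6 := by nlinarith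
        positivity
      · refine hge hw ?_
        nlinarith

/-! ### Remainders of `cosh` and variation diminishing -/

/-- The remainder of the Taylor polynomial with `m` terms of `cosh` at `0`. -/
def coshRem (m : ℕ) (x : ℝ) : ℝ :=
  Real.cosh x - ∑ n ∈ Finset.range m, x ^ (2 * n) / ((2 * n).factorial : ℝ)

lemma hasSum_coshRem (m : ℕ) (x : ℝ) :
    HasSum (fun n ↦ x ^ (2 * (n + m)) / ((2 * (n + m)).factorial : ℝ)) (coshRem m x) :=
  (hasSum_nat_add_iff' (f := fun n ↦ x ^ (2 * n) / ((2 * n).factorial : ℝ)) m).2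
    (Real.hasSum_cosh x)

lemma coshRem_nonneg (m : ℕ) (x : ℝ) : 0 ≤ coshRem m x :=
  (hasSum_coshRem m x).nonneg fun n ↦ by
    rw [pow_mul]; positivity

/-- For `m ≥ 1` every term of the series has a nonnegative coefficient and a factor `x²`, so the
remainder divided by `x²` is nondecreasing in `x²`; the statement is cleared of denominators. -/
lemma sq_mul_coshRem_le {a b : ℝ} (k : ℝ) (h : a ^ 2 ≤ b ^ 2) {m : ℕ} (hm : 1 ≤ m) :
    b ^ 2 * coshRem m (k * a) ≤ a ^ 2 * coshRem m (k * b) := by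
  refine hasSum_le (fun n ↦ ?_) ((hasSum_coshRem m (k * a)).mul_left (b ^ 2))
    ((hasSum_coshRem m (k * b)).mul_left (a ^ 2))
  obtain ⟨j, hj⟩ : ∃ j, n + m = j + 1 := ⟨n + m - 1, by omega⟩
  rw [hj, ← mul_div_assoc, ← mul_div_assoc]
  refine div_le_div_of_nonneg_right ?_ (by positivity)
  have h1 : (a ^ 2) ^ j ≤ (b ^ 2) ^ j := by gcongr
  calc b ^ 2 * (k * a) ^ (2 * (j + 1))
      = (k ^ 2) ^ (j + 1) * a ^ 2 * b ^ 2 * (a ^ 2) ^ j := by rw [pow_mul]; ring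
    _ ≤ (k ^ 2) ^ (j + 1) * a ^ 2 * b ^ 2 * (b ^ 2) ^ j := by gcongr
    _ = a ^ 2 * (k * b) ^ (2 * (j + 1)) := by rw [pow_mul]; ring

lemma ExpGrowth.cosh_mul (k : ℝ) : ExpGrowth fun w ↦ Real.cosh (k * w) := by
  have := ((ExpGrowth.exp_mul k).add (ExpGrowth.exp_mul (-k))).const_mul 2⁻¹
  convert this using 2 with w
  rw [Real.cosh_eq, neg_mul]; ring

lemma ExpGrowth.coshRem (m : ℕ) (k : ℝ) : ExpGrowth fun w ↦ PretestMSE.coshRem m (k * w) :=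
  (ExpGrowth.cosh_mul k).mono
    (by unfold PretestMSE.coshRem; fun_prop) fun w ↦ by
      rw [abs_of_nonneg (coshRem_nonneg m _), abs_of_pos (Real.cosh_pos _), PretestMSE.coshRem,
        sub_le_self_iff]
      exact Finset.sum_nonneg fun n _ ↦ by rw [pow_mul]; positivity

/-- Variation diminishing: since the risk kernel changes sign once, a nonnegative second moment
makes its integrals against all the remainders of `cosh` nonnegative. -/
lemma integral_riskKernel_mul_coshRem_nonneg {lam : ℝ} (hlam : 0 < lam)
    (h1 : 0 ≤ ∫ w, riskKernel lam w * w ^ 2 ∂(gaussianReal 0 1)) {m : ℕ} (hm : 1 ≤ m) (k : ℝ) :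
    0 ≤ ∫ w, riskKernel lam w * coshRem m (k * w) ∂(gaussianReal 0 1) := by
  obtain ⟨t, ht, hsign⟩ := exists_sign_change hlam
  have hst : √t ^ 2 = t := Real.sq_sqrt ht.le
  have hR := ExpGrowth.riskKernel hlam.le
  have hA := (hR.mul (.coshRem m k)).const_mul t
  have hB := (hR.mul (ExpGrowth.id.pow 2)).const_mul (coshRem m (k * √t))
  -- The kernel and `t * coshRem m (k w) - w² * coshRem m (k √t)` both pass from nonpositive to
  -- nonnegative at `w² = t`, where the latter vanishes; their product is nonnegative pointwise.
  have key : ∫ w, coshRem m (k * √t) * (riskKernel lam w * w ^ 2) ∂(gaussianReal 0 1) ≤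
      ∫ w, t * (riskKernel lam w * coshRem m (k * w)) ∂(gaussianReal 0 1) := by
    refine integral_mono hB.integrable hA.integrable fun w ↦ ?_
    have hle (h : w ^ 2 ≤ t) : t * coshRem m (k * w) ≤ w ^ 2 * coshRem m (k * √t) := by
      have := sq_mul_coshRem_le k (a := w) (b := √t) (by rwa [hst]) hm
      rwa [hst] at this
    have hge (h : t ≤ w ^ 2) : w ^ 2 * coshRem m (k * √t) ≤ t * coshRem m (k * w) := by
      have := sq_mul_coshRem_le k (a := √t) (b := w) (by rwa [hst]) hm
      rwa [hst] at this
    simp only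
    rcases le_or_gt (w ^ 2) t with h | h
    · rcases (hsign w).1 h with h' | h'
      · nlinarith [hle h]
      · exact le_of_eq (by
          linear_combination (-riskKernel lam w) * le_antisymm (hle h) (hge h'.ge))
    · nlinarith [hge h.le, (hsign w).2 h]
  rw [integral_const_mul, integral_const_mul] at key
  exact nonneg_of_mul_nonneg_right ((mul_nonneg (coshRem_nonneg m _) h1).trans key) ht

/-! ### The risk at mean zero -/

lemma shrinkRisk_sub_zero {lam : ℝ} (hlam : 0 ≤ lam) :
    shrinkRisk lam 0 - shrinkRisk 0 0 = ∫ w, riskKernel lam w ∂(gaussianReal 0 1) := by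
  simp [shrinkRisk_sub_eq hlam]

lemma sub_psi (lam w : ℝ) :
    w - psi lam w = w * (max 0 (w ^ 2 - lam) / (1 + max 0 (w ^ 2 - lam))) := by
  rw [psi]
  field_simp [(psi_den_pos lam w).ne']
  ring

/-- The residual is `w * (m / (1 + m))` with `m = max 0 (w² - lam)`; raising the threshold lowers
`m`, hence the factor. -/
lemma sub_psi_sq_anti (w : ℝ) : Antitone fun lam ↦ (w - psi lam w) ^ 2 := by
  intro a b hab
  simp only [sub_psi, mul_pow]
  have h1 : max 0 (w ^ 2 - b) ≤ max 0 (w ^ 2 - a) := max_le_max le_rfl (by linarith)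
  have h0 : 0 ≤ max 0 (w ^ 2 - b) := le_max_left _ _
  have h2 : max 0 (w ^ 2 - b) / (1 + max 0 (w ^ 2 - b)) ≤
      max 0 (w ^ 2 - a) / (1 + max 0 (w ^ 2 - a)) := by
    rw [div_le_div_iff₀ (by positivity) (by positivity)]
    nlinarith
  gcongr

lemma sub_psi_sq_lt {a b w : ℝ} (hab : a < b) (hw : b < w ^ 2) (hw0 : w ≠ 0) :
    (w - psi b w) ^ 2 < (w - psi a w) ^ 2 := by
  simp only [sub_psi, mul_pow]
  rw [max_eq_right (by linarith), max_eq_right (by linarith)]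
  have h2 : (w ^ 2 - b) / (1 + (w ^ 2 - b)) < (w ^ 2 - a) / (1 + (w ^ 2 - a)) := by
    rw [div_lt_div_iff₀ (by linarith) (by linarith)]
    nlinarith
  have h3 : 0 ≤ (w ^ 2 - b) / (1 + (w ^ 2 - b)) :=
    div_nonneg (by linarith) (by linarith)
  gcongr

lemma shrinkRisk_zero (lam : ℝ) :
    shrinkRisk lam 0 = ∫ w, (w - psi lam w) ^ 2 ∂(gaussianReal 0 1) := by
  simp [shrinkRisk]

lemma ExpGrowth.sub_psi_sq (lam : ℝ) : ExpGrowth fun w ↦ (w - PretestMSE.psi lam w) ^ 2 :=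
  (ExpGrowth.id.sub .psi).pow 2

lemma strictAnti_shrinkRisk_zero : StrictAnti fun lam ↦ shrinkRisk lam 0 := by
  intro a b hab
  simp only [shrinkRisk_zero]
  rw [← sub_pos, ← integral_sub (ExpGrowth.sub_psi_sq a).integrable
    (ExpGrowth.sub_psi_sq b).integrable, integral_pos_iff_support_of_nonneg
    (fun w ↦ sub_nonneg.2 (sub_psi_sq_anti w hab.le))
    ((ExpGrowth.sub_psi_sq a).integrable.sub (ExpGrowth.sub_psi_sq b).integrable)]
  -- The inequality is strict for `w > √|b|`, a half-line of positive Gaussian mass; the absolute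
  -- value allows negative thresholds.
  refine lt_of_lt_of_le (pos_iff_ne_zero.2 fun h ↦ ?_)
    (measure_mono (s := Set.Ioi √|b|) fun w hw ↦ ?_)
  · simpa using gaussianReal_absolutelyContinuous' 0 one_ne_zero h
  · have hw : √|b| < w := hw
    have h0 : 0 < w := (Real.sqrt_nonneg _).trans_lt hw
    exact (sub_pos.2 (sub_psi_sq_lt hab ((le_abs_self b).trans_lt
      ((Real.sqrt_lt' h0).1 hw)) h0.ne')).ne'

/-- For fixed `w` the residual vanishes once `lam ≥ w²`, and the residual at `lam = 0` dominates. -/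
lemma tendsto_shrinkRisk_zero : Tendsto (fun lam ↦ shrinkRisk lam 0) atTop (𝓝 0) := by
  simp only [shrinkRisk_zero]
  have := tendsto_integral_filter_of_dominated_convergence (μ := gaussianReal 0 1) (l := atTop)
    (F := fun lam w ↦ (w - psi lam w) ^ 2) (f := fun _ ↦ 0) (fun w ↦ (w - psi 0 w) ^ 2)
    (Eventually.of_forall fun lam ↦ (ExpGrowth.sub_psi_sq lam).measurable.aestronglyMeasurable)
    ((eventually_ge_atTop 0).mono fun lam hlam ↦ ae_of_all _ fun w ↦ by
      rw [Real.norm_eq_abs, abs_of_nonneg (sq_nonneg _)]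
      exact sub_psi_sq_anti w hlam)
    (ExpGrowth.sub_psi_sq 0).integrable
    (ae_of_all _ fun w ↦ tendsto_const_nhds.congr' (by
      filter_upwards [eventually_ge_atTop (w ^ 2)] with lam hlam
      simp [psi_of_le hlam]))
  simpa using this

/-! ### Regret against gain, given the two moment inequalities -/

/-- The maximal gain is attained at `0` and is smaller than the regret at `√3`, provided that two
moments of the risk kernel are positive. -/
lemma gain_lt_regret {lam : ℝ} (hlam : 0 < lam)
    (h1 : 0 ≤ ∫ w, riskKernel lam w * w ^ 2 ∂(gaussianReal 0 1))
    (hL : 0 < ∫ w, riskKernel lam w * (11 / 2 + 3 / 2 * w ^ 2 + 3 / 8 * (w ^ 2) ^ 2 +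
      3 / 80 * (w ^ 2) ^ 3) ∂(gaussianReal 0 1)) :
    (∀ k, shrinkRisk 0 k - shrinkRisk lam k ≤ shrinkRisk 0 0 - shrinkRisk lam 0) ∧
      shrinkRisk 0 0 - shrinkRisk lam 0 < shrinkRisk lam √3 - shrinkRisk 0 √3 := by
  have hR := ExpGrowth.riskKernel hlam.le
  have ha0 : ∫ w, riskKernel lam w ∂(gaussianReal 0 1) < 0 := by
    rw [← shrinkRisk_sub_zero hlam.le, sub_neg]
    exact strictAnti_shrinkRisk_zero hlam
  constructor
  · intro k
    suffices ∫ w, riskKernel lam w ∂(gaussianReal 0 1) ≤ shrinkRisk lam k - shrinkRisk 0 k by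
      rw [← shrinkRisk_sub_zero hlam.le] at this; linarith
    have h := integral_riskKernel_mul_coshRem_nonneg hlam h1 le_rfl k
    have h2 : ∫ w, riskKernel lam w * coshRem 1 (k * w) ∂(gaussianReal 0 1) =
        ∫ w, riskKernel lam w * Real.cosh (k * w) ∂(gaussianReal 0 1) -
          ∫ w, riskKernel lam w ∂(gaussianReal 0 1) := by
      rw [← integral_sub (hR.mul (.cosh_mul k)).integrable hR.integrable]
      congr 1 with w
      simp [coshRem]; ring
    rw [shrinkRisk_sub_eq hlam.le]
    have h3 : Real.exp (-k ^ 2 / 2) ≤ 1 := Real.exp_le_one_iff.2 (by nlinarith)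
    -- As the mean of the kernel is negative, multiplying it by `exp (-k² / 2) ≤ 1` can only raise
    -- it.
    have h4 := mul_le_mul_of_nonneg_left (sub_nonneg.1 (h2 ▸ h)) (Real.exp_pos (-k ^ 2 / 2)).le
    nlinarith
  -- The first four terms of `cosh (√3 w)` are the cubic weight minus `9/2`: the constant `1` is
  -- split as `11/2 - 9/2` so that `9/2` times the gain appears.
  · have h := integral_riskKernel_mul_coshRem_nonneg hlam h1 (m := 4) (by norm_num) √3
    have h2 : ∫ w, riskKernel lam w * coshRem 4 (√3 * w) ∂(gaussianReal 0 1) =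
        ∫ w, riskKernel lam w * Real.cosh (√3 * w) ∂(gaussianReal 0 1) -
          ∫ w, riskKernel lam w * (11 / 2 + 3 / 2 * w ^ 2 + 3 / 8 * (w ^ 2) ^ 2 +
            3 / 80 * (w ^ 2) ^ 3) ∂(gaussianReal 0 1) +
          ∫ w, 9 / 2 * riskKernel lam w ∂(gaussianReal 0 1) := by
      have hp : ExpGrowth fun w : ℝ ↦ (11 / 2 + 3 / 2 * w ^ 2 + 3 / 8 * (w ^ 2) ^ 2 +
          3 / 80 * (w ^ 2) ^ 3) :=
        (((ExpGrowth.const _).add ((ExpGrowth.id.pow 2).const_mul _)).add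
          (((ExpGrowth.id.pow 2).pow 2).const_mul _)).add
          (((ExpGrowth.id.pow 2).pow 3).const_mul _)
      rw [← integral_sub (hR.mul (.cosh_mul _)).integrable (hR.mul hp).integrable,
        ← integral_add ((hR.mul (.cosh_mul _)).sub (hR.mul hp)).integrable
          (hR.const_mul _).integrable]
      congr 1 with w
      have e1 : (√3 * w) ^ 2 = 3 * w ^ 2 := by
        rw [mul_pow, Real.sq_sqrt (by norm_num)]
      have e2 : (√3 * w) ^ 4 = 9 * (w ^ 2) ^ 2 := by
        rw [show (√3 * w) ^ 4 = ((√3 * w) ^ 2) ^ 2 by ring, e1]; ring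
      have e3 : (√3 * w) ^ 6 = 27 * (w ^ 2) ^ 3 := by
        rw [show (√3 * w) ^ 6 = ((√3 * w) ^ 2) ^ 3 by ring, e1]; ring
      simp only [coshRem, Finset.sum_range_succ, Finset.sum_range_zero, Nat.reduceMul, e1, e2, e3]
      norm_num [Nat.factorial]
      ring
    rw [integral_const_mul] at h2
    rw [shrinkRisk_sub_eq hlam.le, ← neg_sub (shrinkRisk lam 0), shrinkRisk_sub_zero hlam.le,
      Real.sq_sqrt' , max_eq_left (by norm_num : (0 : ℝ) ≤ 3)]
    -- Here `exp (3/2)` is about `4.48`, just below `9/2`.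
    have he : 1 ≤ Real.exp (-3 / 2) * (9 / 2) := by
      have h3 : Real.exp (3 / 2) ^ 2 = Real.exp 1 ^ 3 := by
        rw [← Real.exp_nat_mul, ← Real.exp_nat_mul]; norm_num
      have h4 : Real.exp 1 ^ 3 ≤ 2.7182818286 ^ 3 := by
        gcongr; exact Real.exp_one_lt_d9.le
      have h5 : Real.exp (3 / 2) ≤ 9 / 2 := by
        refine le_of_sq_le_sq ?_ (by norm_num)
        rw [h3]; exact h4.trans (by norm_num)
      rw [neg_div, Real.exp_neg, inv_mul_eq_div, le_div_iff₀ (Real.exp_pos _), one_mul]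
      exact h5
    have h6 : -(9 / 2) * ∫ w, riskKernel lam w ∂(gaussianReal 0 1) <
        ∫ w, riskKernel lam w * Real.cosh (√3 * w) ∂(gaussianReal 0 1) := by linarith
    have h7 := mul_lt_mul_of_pos_left h6 (Real.exp_pos (-3 / 2))
    nlinarith

lemma abs_psi_sub_mul_le {lam : ℝ} (hlam : 0 ≤ lam) (k x : ℝ) :
    |(psi lam (k + x) - psi 0 (k + x)) * (psi lam (k + x) + psi 0 (k + x) - 2 * x)| ≤
      |psi lam (k + x) - psi 0 (k + x)| * (2 + lam + 2 * |x|) := by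
  rw [abs_mul]
  gcongr
  have h1 := abs_psi_le' hlam (k + x)
  have h2 := abs_psi_le' le_rfl (k + x)
  rw [abs_le] at *
  constructor <;> linarith [neg_abs_le x, le_abs_self x]

lemma abs_psi_sub_le {lam : ℝ} (hlam : 0 ≤ lam) (w : ℝ) : |psi lam w - psi 0 w| ≤ 2 + lam := by
  have h1 := abs_psi_le' hlam w
  have h2 := abs_psi_le' le_rfl w
  rw [abs_le] at *
  constructor <;> linarith

lemma integrable_abs_bound (c d : ℝ) :
    Integrable (fun x ↦ c * (d + 2 * |x|)) (gaussianReal 0 1) :=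
  (((ExpGrowth.const d).add ((ExpGrowth.id.mono (F := fun x ↦ |x|) (by fun_prop)
    (by simp)).const_mul 2)).const_mul c).integrable

lemma continuous_shrinkRisk_sub {lam : ℝ} (hlam : 0 ≤ lam) :
    Continuous fun k ↦ shrinkRisk lam k - shrinkRisk 0 k := by
  simp only [shrinkRisk_sub]
  have hc := continuous_psi lam
  have hc0 := continuous_psi 0
  refine continuous_of_dominated (fun k ↦ by fun_prop) (fun k ↦ ae_of_all _ fun x ↦ ?_)
    (integrable_abs_bound (2 + lam) (2 + lam)) (ae_of_all _ fun x ↦ by fun_prop)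
  refine (abs_psi_sub_mul_le hlam k x).trans ?_
  gcongr
  exact abs_psi_sub_le hlam _

lemma tendsto_psi_cocompact {lam : ℝ} (hlam : 0 ≤ lam) :
    Tendsto (psi lam) (cocompact ℝ) (𝓝 0) := by
  have h : Tendsto (fun w : ℝ ↦ (1 + lam) * ‖w‖⁻¹) (cocompact ℝ) (𝓝 ((1 + lam) * 0)) :=
    ((tendsto_norm_cocompact_atTop (E := ℝ)).inv_tendsto_atTop).const_mul _
  rw [mul_zero] at h
  refine squeeze_zero_norm (fun w ↦ (abs_psi_le hlam w).trans ?_) h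
  rw [mul_div_assoc, Real.norm_eq_abs]
  gcongr
  rcases eq_or_ne w 0 with rfl | hw
  · simp
  · rw [← one_div, div_le_div_iff₀ (by positivity) (by positivity), ← sq, sq_abs]
    linarith

/-- For fixed `x` both shrinkage functions vanish at infinity while the other factor stays
convergent; together with positivity at `√3` this makes the maximal regret attained. -/
lemma tendsto_shrinkRisk_sub {lam : ℝ} (hlam : 0 ≤ lam) :
    Tendsto (fun k ↦ shrinkRisk lam k - shrinkRisk 0 k) (cocompact ℝ) (𝓝 0) := by
  simp only [shrinkRisk_sub]
  have : (cocompact ℝ).IsCountablyGenerated := by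
    rw [cocompact_eq_atBot_atTop]; infer_instance
  have hc := measurable_psi lam
  have hc0 := measurable_psi 0
  have := tendsto_integral_filter_of_dominated_convergence (μ := gaussianReal 0 1)
    (l := cocompact ℝ) (F := fun k x ↦ (psi lam (k + x) - psi 0 (k + x)) *
      (psi lam (k + x) + psi 0 (k + x) - 2 * x)) (f := fun _ ↦ 0)
    (fun x ↦ (2 + lam) * (2 + lam + 2 * |x|)) (Eventually.of_forall fun k ↦ by fun_prop)
    (Eventually.of_forall fun k ↦ ae_of_all _ fun x ↦ by
      refine (abs_psi_sub_mul_le hlam k x).trans ?_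
      gcongr
      exact abs_psi_sub_le hlam _)
    (integrable_abs_bound (2 + lam) (2 + lam)) (ae_of_all _ fun x ↦ by
      have hs : Tendsto (fun k : ℝ ↦ k + x) (cocompact ℝ) (cocompact ℝ) :=
        (Homeomorph.addRight x).isClosedEmbedding.tendsto_cocompact
      have h1 := (tendsto_psi_cocompact hlam).comp hs
      have h2 := (tendsto_psi_cocompact le_rfl).comp hs
      simpa using (h1.sub h2).mul ((h1.add h2).sub_const (2 * x)))
  simpa using this

/-- The maximal regret and the maximal gain are attained, and the former is larger, provided that two
moments of the risk kernel are positive. -/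
lemma exists_max_regret_gain_of_moments {lam : ℝ} (hlam : 0 < lam)
    (h1 : 0 ≤ ∫ w, riskKernel lam w * w ^ 2 ∂(gaussianReal 0 1))
    (hL : 0 < ∫ w, riskKernel lam w * (11 / 2 + 3 / 2 * w ^ 2 + 3 / 8 * (w ^ 2) ^ 2 +
      3 / 80 * (w ^ 2) ^ 3) ∂(gaussianReal 0 1)) :
    ∃ k₁ k₂ : ℝ, (∀ k, shrinkRisk lam k - shrinkRisk 0 k ≤ shrinkRisk lam k₁ - shrinkRisk 0 k₁) ∧
      (∀ k, shrinkRisk 0 k - shrinkRisk lam k ≤ shrinkRisk 0 k₂ - shrinkRisk lam k₂) ∧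
      shrinkRisk 0 k₂ - shrinkRisk lam k₂ < shrinkRisk lam k₁ - shrinkRisk 0 k₁ := by
  obtain ⟨hgain, hlt⟩ := gain_lt_regret hlam h1 hL
  have hpos : 0 < shrinkRisk lam √3 - shrinkRisk 0 √3 :=
    (sub_pos.2 (strictAnti_shrinkRisk_zero hlam)).trans hlt
  obtain ⟨k₁, hk₁⟩ := (continuous_shrinkRisk_sub hlam.le).exists_forall_ge' √3
    (((tendsto_shrinkRisk_sub hlam.le).eventually_lt_const hpos).mono fun _ h ↦ h.le)
  exact ⟨k₁, 0, hk₁, hgain, hlt.trans_le (hk₁ _)⟩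

/-! ### Mills' ratio and Gaussian means of rational functions -/

/-- The mean of `1 / (1 + w ^ 2)` under the standard normal law (Mills' ratio at `1`). -/
def millsOne : ℝ := ∫ w : ℝ, (1 + w ^ 2)⁻¹ ∂(gaussianReal 0 1)

lemma ExpGrowth.inv_one_add_sq : ExpGrowth fun w ↦ (1 + w ^ 2)⁻¹ :=
  .of_bounded (by fun_prop) 1 fun w ↦ by
    rw [abs_of_pos (by positivity)]
    exact inv_le_one_of_one_le₀ (by nlinarith)

lemma integral_sq_pow_succ (n : ℕ) :
    ∫ w : ℝ, (w ^ 2) ^ (n + 1) ∂(gaussianReal 0 1) =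
      (2 * n + 1) * ∫ w : ℝ, (w ^ 2) ^ n ∂(gaussianReal 0 1) := by
  have h := stein (F := fun w ↦ w ^ (2 * n + 1)) (F' := fun w ↦ (2 * n + 1) * (w ^ 2) ^ n)
    Set.countable_empty (by fun_prop) (fun x _ ↦ by
      have := hasDerivAt_pow (2 * n + 1) x
      simp only [Nat.add_sub_cancel, pow_mul] at this
      exact_mod_cast this) (ExpGrowth.id.pow _) (((ExpGrowth.id.pow 2).pow n).const_mul _)
  rw [← integral_const_mul, h]
  congr 1 with w
  ring

lemma integral_sq_pow :
    ∫ w : ℝ, (w ^ 2) ^ 1 ∂(gaussianReal 0 1) = 1 ∧ ∫ w : ℝ, (w ^ 2) ^ 2 ∂(gaussianReal 0 1) = 3 ∧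
    ∫ w : ℝ, (w ^ 2) ^ 3 ∂(gaussianReal 0 1) = 15 ∧
    ∫ w : ℝ, (w ^ 2) ^ 4 ∂(gaussianReal 0 1) = 105 := by
  have h0 := integral_sq_pow_succ 0
  have h1 := integral_sq_pow_succ 1
  have h2 := integral_sq_pow_succ 2
  have h3 := integral_sq_pow_succ 3
  norm_num at h0 h1 h2 h3
  norm_num [h0, h1, h2, h3]

/-- `F` is integrable against the standard normal law, with mean `m`. -/
def HasMean (F : ℝ → ℝ) (m : ℝ) : Prop :=
  Integrable F (gaussianReal 0 1) ∧ ∫ w, F w ∂(gaussianReal 0 1) = m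

namespace HasMean

variable {F G : ℝ → ℝ} {m m' : ℝ}

lemma const (c : ℝ) : HasMean (fun _ ↦ c) c := ⟨integrable_const c, by simp⟩

lemma add (hF : HasMean F m) (hG : HasMean G m') : HasMean (fun w ↦ F w + G w) (m + m') :=
  ⟨hF.1.add hG.1, by rw [integral_add hF.1 hG.1, hF.2, hG.2]⟩

lemma const_mul (c : ℝ) (hF : HasMean F m) : HasMean (fun w ↦ c * F w) (c * m) :=
  ⟨hF.1.const_mul c, by rw [integral_const_mul, hF.2]⟩

lemma sub (hF : HasMean F m) (hG : HasMean G m') : HasMean (fun w ↦ F w - G w) (m - m') :=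
  ⟨hF.1.sub hG.1, by rw [integral_sub hF.1 hG.1, hF.2, hG.2]⟩

lemma congr (hF : HasMean F m) (h : ∀ w, G w = F w) (hm : m' = m) : HasMean G m' := by
  rw [hm, show G = F from funext h]; exact hF

lemma nonneg (hF : HasMean F m) (h : ∀ w, 0 ≤ F w) : 0 ≤ m := hF.2 ▸ integral_nonneg h

lemma millsOne : HasMean (fun w ↦ (1 + w ^ 2)⁻¹) millsOne :=
  ⟨ExpGrowth.inv_one_add_sq.integrable, rfl⟩

lemma polynomial (c₀ c₁ c₂ c₃ c₄ : ℝ) :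
    HasMean (fun w ↦ c₀ + c₁ * w ^ 2 + c₂ * (w ^ 2) ^ 2 + c₃ * (w ^ 2) ^ 3 + c₄ * (w ^ 2) ^ 4)
      (c₀ + c₁ + 3 * c₂ + 15 * c₃ + 105 * c₄) := by
  obtain ⟨h1, h2, h3, h4⟩ := integral_sq_pow
  have hi (n : ℕ) := ((ExpGrowth.id.pow 2).pow n).integrable
  exact (((((const c₀).add (const_mul c₁ ⟨hi 1, h1⟩)).add (const_mul c₂ ⟨hi 2, h2⟩)).add
    (const_mul c₃ ⟨hi 3, h3⟩)).add (const_mul c₄ ⟨hi 4, h4⟩)).congr (fun w ↦ by ring) (by ring)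

/-- Stein's identity for `w / (1 + w²)` equates the mean of `2 / (1 + w²)² - 1 / (1 + w²)` with that
of `w² / (1 + w²)`, and `millsOne` cancels. -/
lemma inv_sq : HasMean (fun w ↦ ((1 + w ^ 2)⁻¹) ^ 2) (1 / 2) := by
  have hi := ExpGrowth.inv_one_add_sq
  have hne (w : ℝ) : 1 + w ^ 2 ≠ 0 := by positivity
  have h1 := stein (F := fun w ↦ w * (1 + w ^ 2)⁻¹)
    (F' := fun w ↦ 2 * ((1 + w ^ 2)⁻¹) ^ 2 - (1 + w ^ 2)⁻¹) Set.countable_empty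
    (continuous_id.mul (Continuous.inv₀ (by fun_prop) hne)) (fun x _ ↦ by
      have hd : HasDerivAt (fun w : ℝ ↦ 1 + w ^ 2) (2 * x) x := by
        simpa using (hasDerivAt_pow 2 x).const_add 1
      refine ((hasDerivAt_id x).fun_mul (hd.fun_inv (hne x))).congr_deriv ?_
      have := hne x
      simp only [_root_.id]
      field_simp
      ring) (ExpGrowth.id.mul hi) (((hi.pow 2).const_mul 2).sub hi)
  have h2 : HasMean (fun w ↦ w * (w * (1 + w ^ 2)⁻¹)) (1 - PretestMSE.millsOne) :=
    ((const 1).sub millsOne).congr (fun w ↦ by have := hne w; field_simp; ring) rfl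
  have h3 : HasMean (fun w ↦ 2 * ((1 + w ^ 2)⁻¹) ^ 2 - (1 + w ^ 2)⁻¹)
      (1 - PretestMSE.millsOne) :=
    ⟨(((hi.pow 2).const_mul 2).sub hi).integrable, h1.trans h2.2⟩
  exact ((h3.add millsOne).const_mul (1 / 2)).congr (fun w ↦ by ring) (by ring)

/-- Stein's identity for `w / (1 + w²)²` expresses the third inverse moment through the first two.
-/
lemma inv_cube : HasMean (fun w ↦ ((1 + w ^ 2)⁻¹) ^ 3) ((1 + PretestMSE.millsOne) / 4) := by
  have hi := ExpGrowth.inv_one_add_sq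
  have hne (w : ℝ) : 1 + w ^ 2 ≠ 0 := by positivity
  have h1 := stein (F := fun w ↦ w * ((1 + w ^ 2)⁻¹) ^ 2)
    (F' := fun w ↦ 4 * ((1 + w ^ 2)⁻¹) ^ 3 - 3 * ((1 + w ^ 2)⁻¹) ^ 2) Set.countable_empty
    (continuous_id.mul ((Continuous.inv₀ (by fun_prop) hne).pow 2)) (fun x _ ↦ by
      have hd : HasDerivAt (fun w : ℝ ↦ 1 + w ^ 2) (2 * x) x := by
        simpa using (hasDerivAt_pow 2 x).const_add 1
      refine ((hasDerivAt_id x).fun_mul ((hd.fun_inv (hne x)).fun_pow 2)).congr_deriv ?_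
      have := hne x
      simp only [_root_.id, Nat.add_one_sub_one, pow_one, Nat.cast_ofNat]
      field_simp
      ring) (ExpGrowth.id.mul (hi.pow 2)) (((hi.pow 3).const_mul 4).sub ((hi.pow 2).const_mul 3))
  have h2 : HasMean (fun w ↦ w * (w * ((1 + w ^ 2)⁻¹) ^ 2)) (PretestMSE.millsOne - 1 / 2) :=
    (millsOne.sub inv_sq).congr (fun w ↦ by have := hne w; field_simp; ring) rfl
  have h3 : HasMean (fun w ↦ 4 * ((1 + w ^ 2)⁻¹) ^ 3 - 3 * ((1 + w ^ 2)⁻¹) ^ 2)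
      (PretestMSE.millsOne - 1 / 2) :=
    ⟨(((hi.pow 3).const_mul 4).sub ((hi.pow 2).const_mul 3)).integrable, h1.trans h2.2⟩
  exact ((h3.add (inv_sq.const_mul 3)).const_mul (1 / 4)).congr (fun w ↦ by ring) (by ring)

/-- The means of the rational functions of `w ^ 2` with a pole of order at most three at `-1`. -/
lemma rational (c₀ c₁ c₂ c₃ c₄ d₁ d₂ d₃ : ℝ) :
    HasMean (fun w ↦ c₀ + c₁ * w ^ 2 + c₂ * (w ^ 2) ^ 2 + c₃ * (w ^ 2) ^ 3 + c₄ * (w ^ 2) ^ 4 +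
        d₁ * (1 + w ^ 2)⁻¹ + d₂ * ((1 + w ^ 2)⁻¹) ^ 2 + d₃ * ((1 + w ^ 2)⁻¹) ^ 3)
      (c₀ + c₁ + 3 * c₂ + 15 * c₃ + 105 * c₄ + d₁ * PretestMSE.millsOne + d₂ * (1 / 2) +
        d₃ * ((1 + PretestMSE.millsOne) / 4)) :=
  (((polynomial c₀ c₁ c₂ c₃ c₄).add (millsOne.const_mul d₁)).add (inv_sq.const_mul d₂)).add
    (inv_cube.const_mul d₃)

end HasMean

/-- The mean of `q(1 + w²)² / (1 + w²)³`, for a quadratic `q`, is nonnegative and affine in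
`millsOne` (about `0.656`). For this `q` it is close to zero and its slope is positive. -/
lemma le_millsOne : 13 / 20 ≤ millsOne := by
  have h := (HasMean.rational (1 - 46 / 5) 1 0 0 0 (729 / 25) (-184 / 5) 16).nonneg fun w ↦ by
    have : 0 ≤ ((1 + w ^ 2) ^ 2 - 23 / 5 * (1 + w ^ 2) + 4) ^ 2 * ((1 + w ^ 2)⁻¹) ^ 3 := by
      positivity
    refine this.trans_eq ?_
    field_simp
    ring
  linarith

/-- Same method; the extra factor `w²` makes the coefficient of `millsOne` negative. -/
lemma millsOne_le : millsOne ≤ 33 / 50 := by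
  have h := (HasMean.rational (1 - 61 / 4 + 5329 / 64) (2 - 61 / 4) 1 0 0 (-12739 / 64)
      (13651 / 64) (-5329 / 64)).nonneg fun w ↦ by
    have : 0 ≤ w ^ 2 * ((1 + w ^ 2) ^ 2 - 57 / 8 * (1 + w ^ 2) + 73 / 8) ^ 2 *
        ((1 + w ^ 2)⁻¹) ^ 3 := by
      positivity
    refine this.trans_eq ?_
    field_simp
    ring
  linarith

/-! ### Moments of the risk kernel as integrals over the threshold -/

/-- A smooth weight `L (w ^ 2)`, with its derivative `dL`. -/
structure SmoothWeight (L dL : ℝ → ℝ) : Prop where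
  hasDerivAt : ∀ s, HasDerivAt L (dL s) s
  continuous_deriv : Continuous dL
  expGrowth : ∀ μ : ℝ, ExpGrowth fun w ↦ L (w ^ 2 + μ)
  expGrowth_deriv : ∀ μ : ℝ, ExpGrowth fun w ↦ dL (w ^ 2 + μ)

/-- The integrand of Stein's identity for the shrinkage function `psi lam`. -/
def steinTerm (L dL : ℝ → ℝ) (lam w : ℝ) : ℝ :=
  psi lam w ^ 2 * L (w ^ 2) + 2 * psi lam w * (2 * w * dL (w ^ 2) - w * L (w ^ 2))

/-- The derivative of `steinTerm` in the threshold. -/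
def layer (L dL : ℝ → ℝ) (μ w : ℝ) : ℝ :=
  if μ < w ^ 2 then
    2 * w ^ 2 * (2 * (1 + (w ^ 2 - μ)) * dL (w ^ 2) - (w ^ 2 - μ) * L (w ^ 2)) /
      (1 + (w ^ 2 - μ)) ^ 3
  else 0

namespace SmoothWeight

variable {L dL : ℝ → ℝ}

lemma continuous (hL : SmoothWeight L dL) : Continuous L :=
  continuous_iff_continuousAt.2 fun s ↦ (hL.hasDerivAt s).continuousAt

lemma expGrowth_sq (hL : SmoothWeight L dL) : ExpGrowth fun w ↦ L (w ^ 2) := by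
  simpa using hL.expGrowth 0

lemma expGrowth_deriv_sq (hL : SmoothWeight L dL) : ExpGrowth fun w ↦ dL (w ^ 2) := by
  simpa using hL.expGrowth_deriv 0

lemma expGrowth_steinTerm (hL : SmoothWeight L dL) (lam : ℝ) :
    ExpGrowth (steinTerm L dL lam) :=
  ((ExpGrowth.psi.pow 2).mul hL.expGrowth_sq).add ((ExpGrowth.psi.const_mul 2).mul
    (((ExpGrowth.id.const_mul 2).mul hL.expGrowth_deriv_sq).sub
      (ExpGrowth.id.mul hL.expGrowth_sq)))

lemma integral_riskKernel (hL : SmoothWeight L dL) {lam : ℝ} (hlam : 0 ≤ lam) :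
    ∫ w, riskKernel lam w * L (w ^ 2) ∂(gaussianReal 0 1) =
      ∫ w, (steinTerm L dL lam w - steinTerm L dL 0 w) ∂(gaussianReal 0 1) :=
  integral_riskKernel_mul (g := fun w ↦ L (w ^ 2)) (g' := fun w ↦ 2 * w * dL (w ^ 2)) hlam
    (fun x ↦ by
      have := (hL.hasDerivAt (x ^ 2)).comp x (hasDerivAt_pow 2 x)
      simp only [Nat.cast_ofNat, Nat.add_one_sub_one, pow_one] at this
      exact this.congr_deriv (by ring)) hL.expGrowth_sq
    ((ExpGrowth.id.const_mul 2).mul hL.expGrowth_deriv_sq)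

/-- A bound uniform in the threshold, which justifies integrating in `μ` and exchanging the
integrals. -/
lemma abs_layer_le (L dL : ℝ → ℝ) (μ w : ℝ) :
    |layer L dL μ w| ≤ 2 * w ^ 2 * (2 * |dL (w ^ 2)| + |L (w ^ 2)|) := by
  unfold layer
  split_ifs with h
  · set m := w ^ 2 - μ with hm
    have hm0 : 0 < m := sub_pos.2 h
    rw [abs_div, abs_of_pos (by positivity : 0 < (1 + m) ^ 3), abs_mul,
      abs_of_nonneg (by positivity : 0 ≤ 2 * w ^ 2), div_le_iff₀ (by positivity),
      mul_assoc (2 * w ^ 2)]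
    refine mul_le_mul_of_nonneg_left ?_ (by positivity)
    have h1 : 1 + m ≤ (1 + m) ^ 3 := by nlinarith [pow_pos hm0 3, sq_nonneg m]
    calc |2 * (1 + m) * dL (w ^ 2) - m * L (w ^ 2)|
        ≤ |2 * (1 + m) * dL (w ^ 2)| + |m * L (w ^ 2)| := abs_sub _ _
      _ = 2 * |dL (w ^ 2)| * (1 + m) + |L (w ^ 2)| * m := by
          rw [abs_mul, abs_mul m, abs_of_pos hm0, abs_of_pos (by positivity : 0 < 2 * (1 + m))]
          ring
      _ ≤ 2 * |dL (w ^ 2)| * (1 + m) ^ 3 + |L (w ^ 2)| * (1 + m) ^ 3 := by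
          gcongr; linarith
      _ = _ := by ring
  · simp only [abs_zero]; positivity

lemma measurable_layer (hL : SmoothWeight L dL) :
    Measurable fun z : ℝ × ℝ ↦ layer L dL z.1 z.2 := by
  have h1 := hL.continuous.measurable
  have h2 := hL.continuous_deriv.measurable
  unfold layer
  exact Measurable.ite (measurableSet_lt (by fun_prop) (by fun_prop)) (by fun_prop)
    measurable_const

/-- The term is continuous in the threshold and differentiable except at `μ = w²`; beyond that point
`psi μ w = w` no longer depends on `μ`. -/
lemma steinTerm_sub (hL : SmoothWeight L dL) {lam : ℝ} (hlam : 0 ≤ lam) (w : ℝ) :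
    steinTerm L dL lam w - steinTerm L dL 0 w = ∫ μ in (0 : ℝ)..lam, layer L dL μ w := by
  have hmeas : Measurable fun μ ↦ layer L dL μ w := 
    hL.measurable_layer.comp (measurable_id.prodMk measurable_const)
  refine (integral_eq_of_hasDerivAt_off_countable_of_le (fun μ ↦ steinTerm L dL μ w) _ hlam
    (Set.countable_singleton (w ^ 2)) ?_ (fun μ hμ ↦ ?_) ?_).symm
  · have : Continuous fun μ ↦ psi μ w := by
      unfold psi
      exact continuous_const.div (by fun_prop) fun μ ↦ (psi_den_pos μ w).ne'
    unfold steinTerm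
    fun_prop
  · rcases lt_or_gt_of_ne hμ.2 with h | h
    · have hne : 1 + w ^ 2 - μ ≠ 0 := by linarith
      have hpsi : HasDerivAt (fun μ ↦ psi μ w) (w / (1 + w ^ 2 - μ) ^ 2) μ := by
        have h1 : HasDerivAt (fun μ : ℝ ↦ w / (1 + w ^ 2 - μ)) (w / (1 + w ^ 2 - μ) ^ 2) μ := by
          have := (hasDerivAt_const μ w).fun_div
            ((hasDerivAt_id μ).const_sub (1 + w ^ 2)) hne
          simpa using this
        refine h1.congr_of_eventuallyEq ?_
        filter_upwards [eventually_lt_nhds h] with x hx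
        exact psi_of_ge hx.le
      have h2 := ((hpsi.fun_pow 2).mul_const (L (w ^ 2))).fun_add
        ((hpsi.const_mul 2).mul_const (2 * w * dL (w ^ 2) - w * L (w ^ 2)))
      refine h2.congr_deriv ?_
      rw [psi_of_ge h.le, layer, if_pos h, ← add_sub_assoc]
      simp only [Nat.cast_ofNat, Nat.add_one_sub_one, pow_one]
      field_simp
      ring
    · rw [layer, if_neg (not_lt.2 (le_of_lt h))]
      refine (hasDerivAt_const μ (steinTerm L dL (w ^ 2) w)).congr_of_eventuallyEq ?_
      filter_upwards [eventually_gt_nhds h] with x hx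
      simp only [steinTerm]
      rw [psi_of_le hx.le, psi_of_le le_rfl]
  · refine (intervalIntegrable_const (c := 2 * w ^ 2 * (2 * |dL (w ^ 2)| + |L (w ^ 2)|))).mono_fun'
      hmeas.aestronglyMeasurable (ae_of_all _ fun μ ↦ abs_layer_le L dL μ w)

lemma integrable_layer (hL : SmoothWeight L dL) (lam : ℝ) :
    Integrable (Function.uncurry fun μ w ↦ layer L dL μ w)
      ((volume.restrict (Set.Ioc 0 lam)).prod (gaussianReal 0 1)) := by
  have hb : ExpGrowth fun w ↦ 2 * w ^ 2 * (2 * |dL (w ^ 2)| + |L (w ^ 2)|) := by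
    have habs {F : ℝ → ℝ} (hF : ExpGrowth F) : ExpGrowth fun w ↦ |F w| :=
      hF.mono hF.measurable.abs (by simp)
    exact ((ExpGrowth.id.pow 2).const_mul 2).mul (((habs hL.expGrowth_deriv_sq).const_mul 2).add
      (habs hL.expGrowth_sq))
  exact (hb.integrable.comp_snd _).mono' hL.measurable_layer.aestronglyMeasurable
    (ae_of_all _ fun z ↦ abs_layer_le L dL z.1 z.2)

lemma integral_riskKernel_eq_layers (hL : SmoothWeight L dL) {lam : ℝ} (hlam : 0 ≤ lam) :
    IntervalIntegrable (fun μ ↦ ∫ w, layer L dL μ w ∂(gaussianReal 0 1)) volume 0 lam ∧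
    ∫ w, riskKernel lam w * L (w ^ 2) ∂(gaussianReal 0 1) =
      ∫ μ in (0 : ℝ)..lam, ∫ w, layer L dL μ w ∂(gaussianReal 0 1) := by
  have hi := hL.integrable_layer lam
  constructor
  · rw [intervalIntegrable_iff_integrableOn_Ioc_of_le hlam]
    exact hi.integral_prod_left
  · rw [hL.integral_riskKernel hlam, intervalIntegral.integral_of_le hlam,
      integral_integral_swap hi]
    congr 1 with w
    rw [hL.steinTerm_sub hlam, intervalIntegral.integral_of_le hlam]

lemma integral_riskKernel_pos (hL : SmoothWeight L dL) {lam : ℝ} (hlam : 0 < lam)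
    (h : ∀ μ ∈ Set.Ioo 0 lam, 0 < ∫ w, layer L dL μ w ∂(gaussianReal 0 1)) :
    0 < ∫ w, riskKernel lam w * L (w ^ 2) ∂(gaussianReal 0 1) := by
  obtain ⟨h1, h2⟩ := hL.integral_riskKernel_eq_layers hlam.le
  rw [h2]
  exact intervalIntegral.intervalIntegral_pos_of_pos_on h1 h hlam

/-- The substitution `w = √(v ^ 2 + μ)` in the integral of a layer. -/
lemma integral_layer_eq (L dL : ℝ → ℝ) {μ : ℝ} (hμ : 0 < μ) :
    ∫ w, layer L dL μ w ∂(gaussianReal 0 1) = 4 * Real.exp (-μ / 2) *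
      ∫ v in Set.Ioi (0 : ℝ), gaussianPDFReal 0 1 v * (√(v ^ 2 + μ) * (v *
        (2 * (1 + v ^ 2) * dL (v ^ 2 + μ) - v ^ 2 * L (v ^ 2 + μ)) / (1 + v ^ 2) ^ 3)) := by
  have h1 : ∫ w, layer L dL μ w ∂(gaussianReal 0 1) =
      2 * ∫ w in Set.Ioi 0, gaussianPDFReal 0 1 w * layer L dL μ w := by
    rw [integral_gaussian_eq, ← integral_comp_abs]
    congr 1 with w
    simp [gaussianPDFReal_zero_one, layer]
  have himage : (fun v : ℝ ↦ √(v ^ 2 + μ)) '' Set.Ioi 0 = Set.Ioi √μ := by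
    ext w
    simp only [Set.mem_image, Set.mem_Ioi]
    constructor
    · rintro ⟨v, hv, rfl⟩
      exact Real.sqrt_lt_sqrt hμ.le (by nlinarith)
    · intro hw
      have hw0 : 0 < w := (Real.sqrt_nonneg μ).trans_lt hw
      have : μ < w ^ 2 := (Real.sqrt_lt' hw0).1 hw
      refine ⟨√(w ^ 2 - μ), Real.sqrt_pos.2 (by linarith), ?_⟩
      rw [Real.sq_sqrt (by linarith), sub_add_cancel, Real.sqrt_sq hw0.le]
  have h2 : ∫ w in Set.Ioi 0, gaussianPDFReal 0 1 w * layer L dL μ w =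
      ∫ w in Set.Ioi √μ, gaussianPDFReal 0 1 w * layer L dL μ w := by
    refine setIntegral_eq_of_subset_of_forall_sdiff_eq_zero measurableSet_Ioi
      (Set.Ioi_subset_Ioi (Real.sqrt_nonneg μ)) fun w hw ↦ ?_
    have hw1 : 0 < w := hw.1
    have hw2 : w ≤ √μ := not_lt.1 hw.2
    have : ¬ μ < w ^ 2 := not_lt.2 ((Real.le_sqrt hw1.le hμ.le).1 hw2)
    simp [layer, this]
  -- With `w² = v² + μ` one has `w dw = v dv`, so the factor `w²` leaves one factor `√(v² + μ)`, and
  -- the density contributes `exp (-μ / 2)`.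
  rw [h1, h2, ← himage, integral_image_eq_integral_deriv_smul_of_monotoneOn measurableSet_Ioi
    (f' := fun v ↦ v / √(v ^ 2 + μ)), ← integral_const_mul, ← integral_const_mul]
  · refine setIntegral_congr_fun measurableSet_Ioi fun v hv ↦ ?_
    have hv : 0 < v := hv
    have hp : 0 < v ^ 2 + μ := by positivity
    have hs := Real.sq_sqrt hp.le
    have hs0 := Real.sqrt_pos.2 hp
    have he : Real.exp (-(v ^ 2 + μ) / 2) = Real.exp (-μ / 2) * Real.exp (-v ^ 2 / 2) := by
      rw [← Real.exp_add]; congr 1; ring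
    simp only [smul_eq_mul]
    rw [layer, hs, if_pos (by nlinarith), gaussianPDFReal_zero_one, gaussianPDFReal_zero_one, hs,
      he, add_sub_cancel_right]
    generalize √(v ^ 2 + μ) = y at *
    rw [← hs]
    field_simp
    ring
  · intro v hv
    have hv : 0 < v := hv
    have hp : v ^ 2 + μ ≠ 0 := by positivity
    have h3 : HasDerivAt (fun v : ℝ ↦ v ^ 2 + μ) (2 * v) v := by
      simpa using (hasDerivAt_pow 2 v).add_const μ
    exact ((h3.sqrt hp).congr_deriv (by field_simp)).hasDerivWithinAt
  · intro a ha b hb hab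
    have ha : 0 < a := ha
    exact Real.sqrt_le_sqrt (by nlinarith)

/-- If `R μ x = 2 (1 + x) L' (x + μ) - x L (x + μ)` changes sign once from positive to negative,
the layer has positive mean as soon as the weight `s R μ s / (1 + s) ^ 3` does. -/
lemma integral_layer_pos (hL : SmoothWeight L dL) {μ t m : ℝ} (hμ : 0 < μ) (ht : 0 < t)
    (h1 : ∀ x, 0 ≤ x → x ≤ t → 0 ≤ 2 * (1 + x) * dL (x + μ) - x * L (x + μ))
    (h2 : ∀ x, t ≤ x → 2 * (1 + x) * dL (x + μ) - x * L (x + μ) ≤ 0)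
    (hm : HasMean (fun w ↦ w ^ 2 * (2 * (1 + w ^ 2) * dL (w ^ 2 + μ) - w ^ 2 * L (w ^ 2 + μ)) *
      ((1 + w ^ 2)⁻¹) ^ 3) m) (hm0 : 0 < m) :
    0 < ∫ w, layer L dL μ w ∂(gaussianReal 0 1) := by
  set R : ℝ → ℝ := fun v ↦ v * (2 * (1 + v ^ 2) * dL (v ^ 2 + μ) - v ^ 2 * L (v ^ 2 + μ)) /
    (1 + v ^ 2) ^ 3 with hR
  have hRg : ExpGrowth R := by
    have := (ExpGrowth.id.mul (((((ExpGrowth.const 1).add (ExpGrowth.id.pow 2)).const_mul 2).mul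
      (hL.expGrowth_deriv μ)).sub ((ExpGrowth.id.pow 2).mul (hL.expGrowth μ)))).mul
        (ExpGrowth.inv_one_add_sq.pow 3)
    simpa only [hR, div_eq_mul_inv, inv_pow] using this
  have hsq : ExpGrowth fun v ↦ √(v ^ 2 + μ) := by
    refine (((ExpGrowth.id.pow 2).add (.const (μ + 1)))).mono (by fun_prop) fun v ↦ ?_
    have h0 : 0 ≤ v ^ 2 + μ := by positivity
    rw [abs_of_nonneg (Real.sqrt_nonneg _), abs_of_nonneg (by positivity)]
    nlinarith [Real.sq_sqrt h0, sq_nonneg (√(v ^ 2 + μ) - 1)]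
  -- The slope for which `c v` meets `√(v² + μ)` at `v² = t`, from below; since `R` turns negative
  -- at the same point, replacing the root by `c v` can only lower the integral and makes the
  -- integrand rational.
  set c : ℝ := √((t + μ) / t) with hc
  have hc0 : 0 < c := Real.sqrt_pos.2 (by positivity)
  have key : ∫ v in Set.Ioi (0 : ℝ), gaussianPDFReal 0 1 v * (c * v * R v) ≤
      ∫ v in Set.Ioi (0 : ℝ), gaussianPDFReal 0 1 v * (√(v ^ 2 + μ) * R v) := by
    refine setIntegral_mono_on (((ExpGrowth.id.const_mul c).mul hRg).integrable_pdf.integrableOn)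
      (hsq.mul hRg).integrable_pdf.integrableOn measurableSet_Ioi fun v hv ↦ ?_
    have hv : 0 < v := hv
    refine mul_le_mul_of_nonneg_left ?_ (gaussianPDFReal_nonneg _ _ _)
    have hcv : c * v = √((t + μ) / t * v ^ 2) := by
      rw [Real.sqrt_mul (by positivity), Real.sqrt_sq hv.le]
    have hcmp : (t + μ) / t * v ^ 2 = v ^ 2 + μ * v ^ 2 / t := by field_simp
    rcases le_total (v ^ 2) t with h | h
    · refine mul_le_mul_of_nonneg_right ?_ ?_
      · rw [hcv, hcmp]
        refine Real.sqrt_le_sqrt ?_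
        gcongr
        rw [div_le_iff₀ ht]; gcongr
      · exact div_nonneg (mul_nonneg hv.le (h1 _ (sq_nonneg v) h)) (by positivity)
    · refine mul_le_mul_of_nonpos_right ?_ ?_
      · rw [hcv, hcmp]
        refine Real.sqrt_le_sqrt ?_
        gcongr
        rw [le_div_iff₀ ht]; gcongr
      · exact div_nonpos_of_nonpos_of_nonneg
          (mul_nonpos_of_nonneg_of_nonpos hv.le (h2 _ h)) (by positivity)
  have hval : m = 2 * ∫ v in Set.Ioi (0 : ℝ), gaussianPDFReal 0 1 v * (v * R v) := by
    rw [← hm.2, integral_gaussian_eq, ← integral_comp_abs]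
    congr 1 with v
    simp only [hR, sq_abs, gaussianPDFReal_zero_one, inv_pow]
    congr 1
    rw [← sq_abs v]
    field_simp
  have hpos : 0 < ∫ v in Set.Ioi (0 : ℝ), gaussianPDFReal 0 1 v * (c * v * R v) := by
    have : ∫ v in Set.Ioi (0 : ℝ), gaussianPDFReal 0 1 v * (c * v * R v) =
        c * ∫ v in Set.Ioi (0 : ℝ), gaussianPDFReal 0 1 v * (v * R v) := by
      rw [← integral_const_mul]; congr 1 with v; ring
    rw [this]
    exact mul_pos hc0 (by linarith)
  rw [integral_layer_eq L dL hμ]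
  exact mul_pos (by positivity) (hpos.trans_le key)

end SmoothWeight

/-! ### Lower bounds for truncated Gaussian moments -/

/-- The inequality `(1 - x/4)⁴ ≤ exp (-x)` at `x = w² / 2`, with `√(2π) ≤ 2.507`, gives a polynomial
minorant of the density that can be integrated exactly. -/
lemma le_gaussianPDFReal {w : ℝ} (hw : w ^ 2 ≤ 8) :
    (1 - w ^ 2 / 8) ^ 4 ≤ 2507 / 1000 * gaussianPDFReal 0 1 w := by
  have h1 : (1 - w ^ 2 / 8) ^ 4 ≤ Real.exp (-w ^ 2 / 2) := by
    have := Real.one_sub_div_pow_le_exp_neg (n := 4) (t := w ^ 2 / 2) (by push_cast; linarith)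
    push_cast at this
    rw [div_div, ← neg_div] at this
    norm_num at this
    exact this
  have h2 : √(2 * Real.pi) ≤ 2507 / 1000 := by
    rw [Real.sqrt_le_left (by norm_num)]
    linarith [Real.pi_lt_d4]
  have h3 : 0 < √(2 * Real.pi) := by positivity
  rw [gaussianPDFReal_zero_one, ← mul_assoc]
  refine h1.trans (le_mul_of_one_le_left (Real.exp_pos _).le ?_)
  rwa [← div_eq_mul_inv, one_le_div h3]

lemma le_integral_indicator {q : ℝ → ℝ} (hq : Continuous q) (hg : ExpGrowth q)
    (h0 : ∀ w, 0 ≤ q w) {a : ℝ} (ha : 0 ≤ a) (ha' : a ^ 2 ≤ 8) :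
    ∫ w in (-a)..a, (1 - w ^ 2 / 8) ^ 4 * q w ≤
      2507 / 1000 * ∫ w, (Set.Icc (-a) a).indicator q w ∂(gaussianReal 0 1) := by
  have h1 : ∫ w, (Set.Icc (-a) a).indicator q w ∂(gaussianReal 0 1) =
      ∫ w in Set.Icc (-a) a, gaussianPDFReal 0 1 w * q w := by
    rw [integral_gaussian_eq, ← integral_indicator measurableSet_Icc]
    congr 1 with w
    by_cases hw : w ∈ Set.Icc (-a) a <;> simp [hw]
  rw [h1, ← integral_const_mul, intervalIntegral.integral_of_le (by linarith),
    ← integral_Icc_eq_integral_Ioc]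
  refine setIntegral_mono_on (Continuous.integrableOn_Icc (by fun_prop))
    (hg.integrable_pdf.const_mul _).integrableOn measurableSet_Icc fun w hw ↦ ?_
  rw [← mul_assoc]
  refine mul_le_mul_of_nonneg_right (le_gaussianPDFReal ?_) (h0 w)
  exact (sq_le_sq' hw.1 hw.2).trans ha'

lemma integral_even_polynomial (a c₀ c₁ c₂ c₃ c₄ c₅ c₆ : ℝ) :
    ∫ w in (-a)..a, (c₀ + c₁ * w ^ 2 + c₂ * w ^ 4 + c₃ * w ^ 6 + c₄ * w ^ 8 + c₅ * w ^ 10 +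
      c₆ * w ^ 12) = 2 * (c₀ * a + c₁ * (a ^ 3 / 3) + c₂ * (a ^ 5 / 5) + c₃ * (a ^ 7 / 7) +
      c₄ * (a ^ 9 / 9) + c₅ * (a ^ 11 / 11) + c₆ * (a ^ 13 / 13)) := by
  have hp (n : ℕ) (c w : ℝ) := ((hasDerivAt_pow n w).div_const (n : ℝ)).const_mul c
  rw [intervalIntegral.integral_eq_sub_of_hasDerivAt (fun w _ ↦
    (((((((hasDerivAt_id w).const_mul c₀).fun_add (hp 3 c₁ w)).fun_add (hp 5 c₂ w)).fun_add
      (hp 7 c₃ w)).fun_add (hp 9 c₄ w)).fun_add (hp 11 c₅ w)).fun_add (hp 13 c₆ w) |>.congr_deriv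
        (by push_cast; ring)) (Continuous.intervalIntegrable (by fun_prop) _ _)]
  simp only [_root_.id]
  push_cast
  ring

/-- The constant is what the second moment needs: `4 * (33/40) = 17/2 - 8 * (13/20)`, where `13/20`
is the lower bound for `millsOne`. -/
lemma le_integral_indicator_one :
    33 / 40 < ∫ w, (Set.Icc (-(3 / 2)) (3 / 2)).indicator (fun _ : ℝ ↦ (1 : ℝ)) w
      ∂(gaussianReal 0 1) := by
  have h := le_integral_indicator (q := fun _ ↦ 1) continuous_const (.const 1)
    (fun _ ↦ zero_le_one) (a := 3 / 2) (by norm_num) (by norm_num)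
  have h2 : ∫ w in (-(3 / 2) : ℝ)..(3 / 2), (1 - w ^ 2 / 8) ^ 4 * (1 : ℝ) =
      ∫ w in (-(3 / 2) : ℝ)..(3 / 2), (1 + -1 / 2 * w ^ 2 + 3 / 32 * w ^ 4 + -1 / 128 * w ^ 6 +
        1 / 4096 * w ^ 8 + 0 * w ^ 10 + 0 * w ^ 12) := by
    congr 1 with w; ring
  rw [h2, integral_even_polynomial] at h
  linarith

lemma le_integral_indicator_poly :
    3 < ∫ w, (Set.Icc (-2) 2).indicator (fun w : ℝ ↦ w ^ 2 * (3 / 2 * w ^ 2 + 5 / 2)) w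
      ∂(gaussianReal 0 1) := by
  have h := le_integral_indicator (q := fun w : ℝ ↦ w ^ 2 * (3 / 2 * w ^ 2 + 5 / 2))
    (by fun_prop) ((ExpGrowth.id.pow 2).mul (((ExpGrowth.id.pow 2).const_mul _).add (.const _)))
    (fun _ ↦ by positivity) (a := 2) (by norm_num) (by norm_num)
  have h2 : ∫ w in (-2 : ℝ)..2, (1 - w ^ 2 / 8) ^ 4 * (w ^ 2 * (3 / 2 * w ^ 2 + 5 / 2)) =
      ∫ w in (-2 : ℝ)..2, (0 + 5 / 2 * w ^ 2 + 1 / 4 * w ^ 4 + -33 / 64 * w ^ 6 +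
        31 / 256 * w ^ 8 + -91 / 8192 * w ^ 10 + 3 / 8192 * w ^ 12) := by
    congr 1 with w; ring
  rw [h2, integral_even_polynomial] at h
  linarith

/-! ### The two moment inequalities -/

lemma smoothWeight_id : SmoothWeight (fun s ↦ s) fun _ ↦ 1 where
  hasDerivAt s := hasDerivAt_id s
  continuous_deriv := continuous_const
  expGrowth μ := (ExpGrowth.id.pow 2).add (.const μ)
  expGrowth_deriv _ := .const 1

/-- The second moment of the risk kernel is nonnegative. -/
lemma integral_riskKernel_sq_pos {lam : ℝ} (hlam : 0 < lam) :
    0 < ∫ w, riskKernel lam w * w ^ 2 ∂(gaussianReal 0 1) := by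
  have hκ := le_millsOne
  have hκ' := millsOne_le
  -- For `μ < 9/4` every layer has positive mean; for `lam > 9/4` the interval `[-3/2, 3/2]` lies
  -- where `psi lam w = w`.
  rcases le_or_gt lam (9 / 4) with h | h
  · refine smoothWeight_id.integral_riskKernel_pos hlam fun μ hμ ↦ ?_
    obtain ⟨hμ0, hμ1⟩ := hμ
    have hμ2 : μ < 9 / 4 := hμ1.trans_le h
    -- The positive root of `2 (1 + x) - x (x + μ)`, where the layer changes sign.
    obtain ⟨t, ht0, ht⟩ : ∃ t : ℝ, 0 < t ∧ t ^ 2 = 2 + (2 - μ) * t := by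
      have hd := Real.sq_sqrt (by positivity : 0 ≤ (2 - μ) ^ 2 + 8)
      have hd0 := Real.sqrt_nonneg ((2 - μ) ^ 2 + 8)
      generalize √((2 - μ) ^ 2 + 8) = y at *
      exact ⟨((2 - μ) + y) / 2, by nlinarith, by linear_combination hd / 4⟩
    have hR (x : ℝ) : (2 * (1 + x) * 1 - x * (x + μ)) * t = (t - x) * (2 + x * t) := by
      linear_combination -x * ht
    refine smoothWeight_id.integral_layer_pos hμ0 ht0 (fun x hx hxt ↦ ?_) (fun x hx ↦ ?_)
      ((HasMean.rational (-1) 0 0 0 0 (5 - μ) (2 * μ - 5) (1 - μ)).congr (fun w ↦ ?_) rfl) ?_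
    · refine nonneg_of_mul_nonneg_left ?_ ht0
      rw [hR]
      have : 0 ≤ t - x := by linarith
      positivity
    · refine nonpos_of_mul_nonpos_left ?_ ht0
      rw [hR]
      have : 0 ≤ x := ht0.le.trans hx
      exact mul_nonpos_of_nonpos_of_nonneg (by linarith) (by positivity)
    · have : 1 + w ^ 2 ≠ 0 := by positivity
      field_simp
      ring
    · nlinarith
  -- The Stein term is `(psi w + 2 - w²)² - (2 - w²)²`. The square equals `4` where `psi lam w = w`,
  -- in particular on `[-3/2, 3/2]`, and is dropped elsewhere.
  · rw [smoothWeight_id.integral_riskKernel hlam.le]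
    have hS : MeasurableSet (Set.Icc (-(3 / 2) : ℝ) (3 / 2)) := measurableSet_Icc
    have h1 : HasMean (fun w : ℝ ↦ (2 - w ^ 2) ^ 2 + steinTerm (fun s ↦ s) (fun _ ↦ 1) 0 w)
        (17 / 2 - 8 * millsOne) :=
      (HasMean.rational 11 (-6) 1 0 0 (-8) 1 0).congr (fun w ↦ by
        have : 1 + w ^ 2 ≠ 0 := by positivity
        simp only [steinTerm, psi_zero_left]
        field_simp
        ring) (by ring)
    have h2 : HasMean ((Set.Icc (-(3 / 2)) (3 / 2)).indicator (fun _ : ℝ ↦ (1 : ℝ))) _ :=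
      ⟨((ExpGrowth.const 1).indicator hS).integrable, rfl⟩
    have h3 := (h2.const_mul 4).sub h1
    have hP := le_integral_indicator_one
    refine lt_of_lt_of_le ?_ (h3.2.symm.trans_le (integral_mono h3.1
      ((smoothWeight_id.expGrowth_steinTerm lam).sub
        (smoothWeight_id.expGrowth_steinTerm 0)).integrable fun w ↦ ?_))
    · linarith
    · simp only [sub_add_eq_sub_sub]
      refine sub_le_sub_right ?_ _
      by_cases hw : w ∈ Set.Icc (-(3 / 2)) (3 / 2)
      · have : w ^ 2 ≤ lam := by nlinarith [hw.1, hw.2]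
        rw [Set.indicator_of_mem hw, steinTerm, psi_of_le this]
        nlinarith
      · rw [Set.indicator_of_notMem hw, steinTerm]
        nlinarith [sq_nonneg (psi lam w * w + 2 - w ^ 2)]

/-- The cubic weight `L`, a lower bound for the one of the regret at `√3`. -/
def cubic (s : ℝ) : ℝ := 11 / 2 + 3 / 2 * s + 3 / 8 * s ^ 2 + 3 / 80 * s ^ 3

/-- The derivative of `cubic`. -/
def cubicDeriv (s : ℝ) : ℝ := 3 / 2 + 3 / 4 * s + 9 / 80 * s ^ 2

lemma hasDerivAt_cubic (s : ℝ) : HasDerivAt cubic (cubicDeriv s) s := by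
  have hp (n : ℕ) (c : ℝ) := (hasDerivAt_pow n s).const_mul c
  refine (((((hasDerivAt_id s).const_mul (3 / 2)).const_add (11 / 2)).fun_add
    (hp 2 (3 / 8))).fun_add (hp 3 (3 / 80))).congr_deriv ?_
  rw [cubicDeriv]
  push_cast
  ring

lemma smoothWeight_cubic : SmoothWeight cubic cubicDeriv where
  hasDerivAt := hasDerivAt_cubic
  continuous_deriv := by unfold cubicDeriv; fun_prop
  expGrowth μ := by
    have h : ExpGrowth fun w ↦ w ^ 2 + μ := (ExpGrowth.id.pow 2).add (.const μ)
    exact (((ExpGrowth.const _).add (h.const_mul _)).add ((h.pow 2).const_mul _)).add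
      ((h.pow 3).const_mul _)
  expGrowth_deriv μ := by
    have h : ExpGrowth fun w ↦ w ^ 2 + μ := (ExpGrowth.id.pow 2).add (.const μ)
    exact ((ExpGrowth.const _).add (h.const_mul _)).add ((h.pow 2).const_mul _)

/-- Monotonicity yields the single sign change that `integral_layer_pos` asks for. With `s = x + μ`
the derivative is `-1 + 9/20 s - 3/20 s² - 3/80 s³ - x (3/10 s + 9/80 s²)`. -/
lemma antitoneOn_cubic_kernel {μ : ℝ} (hμ : 0 ≤ μ) :
    AntitoneOn (fun x ↦ 2 * (1 + x) * cubicDeriv (x + μ) - x * cubic (x + μ)) (Set.Ici 0) := by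
  have hd (x : ℝ) : HasDerivAt (fun x ↦ 2 * (1 + x) * cubicDeriv (x + μ) - x * cubic (x + μ))
      (2 * cubicDeriv (x + μ) + 2 * (1 + x) * (3 / 4 + 9 / 40 * (x + μ)) -
        (cubic (x + μ) + x * cubicDeriv (x + μ))) x := by
    have hs : HasDerivAt (fun x : ℝ ↦ x + μ) 1 x := (hasDerivAt_id x).add_const μ
    have h1 : HasDerivAt (fun x ↦ cubicDeriv (x + μ)) (3 / 4 + 9 / 40 * (x + μ)) x := by
      refine (((hs.const_mul (3 / 4)).const_add (3 / 2)).fun_add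
        ((hs.fun_pow 2).const_mul (9 / 80))).congr_deriv ?_
      push_cast
      ring
    have h2 : HasDerivAt (fun x ↦ cubic (x + μ)) (cubicDeriv (x + μ)) x :=
      (hasDerivAt_cubic (x + μ)).comp_add_const x μ
    have h3 : HasDerivAt (fun x : ℝ ↦ 2 * (1 + x)) 2 x := by
      simpa using ((hasDerivAt_id x).const_add 1).const_mul 2
    exact ((h3.fun_mul h1).fun_sub ((hasDerivAt_id x).fun_mul h2)).congr_deriv (by simp)
  refine antitoneOn_of_deriv_nonpos (convex_Ici 0)
    (fun x _ ↦ (hd x).continuousAt.continuousWithinAt)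
    (fun x _ ↦ (hd x).differentiableAt.differentiableWithinAt) fun x hx ↦ ?_
  rw [interior_Ici] at hx
  have hx : 0 < x := hx
  rw [(hd x).deriv, cubic, cubicDeriv]
  set s := x + μ with hs
  have hs0 : 0 ≤ s := by positivity
  nlinarith [sq_nonneg (s - 3 / 2), mul_nonneg hx.le hs0, mul_nonneg hx.le (sq_nonneg s),
    pow_nonneg hs0 3]

lemma exists_cubic_kernel_root {μ : ℝ} (hμ : 0 ≤ μ) :
    ∃ t : ℝ, 0 < t ∧ 2 * (1 + t) * cubicDeriv (t + μ) - t * cubic (t + μ) = 0 := by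
  have h0 : 0 < 2 * (1 + 0) * cubicDeriv (0 + μ) - 0 * cubic (0 + μ) := by
    rw [cubicDeriv, zero_mul, sub_zero]; positivity
  have h1 : 2 * (1 + 10) * cubicDeriv (10 + μ) - 10 * cubic (10 + μ) ≤ 0 := by
    rw [cubicDeriv, cubic]; nlinarith [pow_nonneg hμ 2, pow_nonneg hμ 3]
  obtain ⟨t, ht, ht'⟩ := intermediate_value_Icc' (by norm_num : (0 : ℝ) ≤ 10)
    (f := fun x ↦ 2 * (1 + x) * cubicDeriv (x + μ) - x * cubic (x + μ))
    (by unfold cubicDeriv cubic; fun_prop) ⟨h1, h0.le⟩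
  refine ⟨t, ht.1.lt_of_ne fun h ↦ ?_, ht'⟩
  subst h
  exact h0.ne' ht'

/-- A linear majorant of `4 L'² / L`, the cost of completing the square in the Stein term; the
polynomial `h` is the difference of the two sides. -/
lemma cubicDeriv_sq_le {s : ℝ} (hs : 0 ≤ s) :
    4 * cubicDeriv s ^ 2 ≤ cubic s * (3 / 2 * s + 5 / 2) := by
  have h : 0 ≤ 19 / 4 + 3 * s - 33 / 80 * s ^ 2 - 3 / 160 * s ^ 3 + 9 / 1600 * s ^ 4 := by
    rcases le_total s 6 with h | h
    · nlinarith [mul_nonneg hs (sub_nonneg.2 h), mul_nonneg (mul_nonneg hs (sub_nonneg.2 h)) hs,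
        sq_nonneg (s ^ 2 - 3 * s)]
    · nlinarith [sq_nonneg (s ^ 2 - 10 * s), sq_nonneg (s ^ 2 - 6 * s), sq_nonneg (s - 6),
        mul_nonneg (sub_nonneg.2 h) (sq_nonneg (s - 8))]
  rw [cubicDeriv, cubic]
  nlinarith

lemma integral_riskKernel_cubic_pos {lam : ℝ} (hlam : 0 < lam) :
    0 < ∫ w, riskKernel lam w * cubic (w ^ 2) ∂(gaussianReal 0 1) := by
  have hκ := le_millsOne
  have hκ' := millsOne_le
  -- As for the second moment: layers up to `4`, and beyond it `[-2, 2]` lies where `psi lam w = w`.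
  rcases le_or_gt lam 4 with h | h
  · refine smoothWeight_cubic.integral_riskKernel_pos hlam fun μ hμ ↦ ?_
    obtain ⟨hμ0, hμ1⟩ := hμ
    have hμ4 : μ < 4 := hμ1.trans_le h
    obtain ⟨t, ht0, ht⟩ := exists_cubic_kernel_root hμ0.le
    have hanti := antitoneOn_cubic_kernel hμ0.le
    refine smoothWeight_cubic.integral_layer_pos hμ0 ht0 (fun x hx hxt ↦ ?_) (fun x hx ↦ ?_)
      ((HasMean.rational (9 / 20 + 3 / 80 * μ - 9 / 80 * μ ^ 2) (-3 / 80 - 9 / 80 * μ) (-3 / 80) 0 0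
        (-11 / 5 + 27 / 40 * μ + 3 / 16 * μ ^ 2 - 3 / 80 * μ ^ 3)
        (487 / 80 + 3 / 20 * μ + 3 / 16 * μ ^ 2 + 3 / 40 * μ ^ 3)
        (-347 / 80 - 69 / 80 * μ - 21 / 80 * μ ^ 2 - 3 / 80 * μ ^ 3)).congr (fun w ↦ ?_) rfl) ?_
    · exact ht.ge.trans (hanti hx ht0.le hxt)
    · exact (hanti ht0.le (ht0.le.trans hx) hx).trans ht.le
    · have : 1 + w ^ 2 ≠ 0 := by positivity
      rw [cubic, cubicDeriv]
      field_simp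
      ring
    · have h1 := mul_nonneg hμ0.le (sub_nonneg.2 hκ)
      have h2 := mul_nonneg (sq_nonneg μ) (sub_nonneg.2 hκ)
      have h3 := mul_nonneg (pow_nonneg hμ0.le 3) (sub_nonneg.2 hκ')
      have h4 := mul_nonneg hμ0.le (sub_nonneg.2 hμ4.le)
      have h5 := mul_nonneg (sq_nonneg μ) (sub_nonneg.2 hμ4.le)
      nlinarith
  -- Completing the square in `psi` and using `cubicDeriv_sq_le`, the Stein term is at least `w² (4
  -- L' - L - (3/2 w² + 5/2))`. Where `psi lam w = w` it equals `w² (4 L' - L)`, so the subtracted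
  -- part is recovered on `[-2, 2]`.
  · rw [smoothWeight_cubic.integral_riskKernel hlam.le]
    have hS : MeasurableSet (Set.Icc (-2 : ℝ) 2) := measurableSet_Icc
    have h1 : HasMean (fun w : ℝ ↦ w ^ 2 * (4 * cubicDeriv (w ^ 2) - cubic (w ^ 2) -
        (3 / 2 * w ^ 2 + 5 / 2)) - steinTerm cubic cubicDeriv 0 w)
        (461 / 160 - 87 / 10 * millsOne) :=
      (HasMean.rational (349 / 80) (-101 / 40) (3 / 16) (3 / 20) (-3 / 80) (-87 / 10) (347 / 80)
        0).congr (fun w ↦ by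
        have : 1 + w ^ 2 ≠ 0 := by positivity
        simp only [steinTerm, psi_zero_left, cubic, cubicDeriv]
        field_simp
        ring) (by ring)
    have h2 : HasMean ((Set.Icc (-2) 2).indicator
        (fun w : ℝ ↦ w ^ 2 * (3 / 2 * w ^ 2 + 5 / 2))) _ :=
      ⟨(((ExpGrowth.id.pow 2).mul (((ExpGrowth.id.pow 2).const_mul _).add
        (.const _))).indicator hS).integrable, rfl⟩
    have h3 := h2.add h1
    have hP := le_integral_indicator_poly
    refine lt_of_lt_of_le ?_ (h3.2.symm.trans_le (integral_mono h3.1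
      ((smoothWeight_cubic.expGrowth_steinTerm lam).sub
        (smoothWeight_cubic.expGrowth_steinTerm 0)).integrable fun w ↦ ?_))
    · linarith
    · simp only [← add_sub_assoc]
      refine sub_le_sub_right ?_ _
      by_cases hw : w ∈ Set.Icc (-2) 2
      · have : w ^ 2 ≤ lam := by nlinarith [hw.1, hw.2]
        rw [Set.indicator_of_mem hw, steinTerm, psi_of_le this]
        exact le_of_eq (by ring)
      · rw [Set.indicator_of_notMem hw, steinTerm, zero_add]
        have hd := cubicDeriv_sq_le (sq_nonneg w)
        have hc : 0 < cubic (w ^ 2) := by rw [cubic]; positivity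
        have hw2 := mul_le_mul_of_nonneg_left hd (sq_nonneg w)
        generalize cubic (w ^ 2) = c at *
        generalize cubicDeriv (w ^ 2) = d at *
        generalize psi lam w = y at *
        rw [← sub_nonneg]
        refine nonneg_of_mul_nonneg_right (a := c) ?_ hc
        nlinarith [sq_nonneg (y * c + w * (2 * d - c))]

/-- The maximal regret and the maximal gain are attained, and the former is larger. -/
lemma exists_max_regret_gain {lam : ℝ} (hlam : 0 < lam) :
    ∃ k₁ k₂ : ℝ, (∀ k, shrinkRisk lam k - shrinkRisk 0 k ≤ shrinkRisk lam k₁ - shrinkRisk 0 k₁) ∧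
      (∀ k, shrinkRisk 0 k - shrinkRisk lam k ≤ shrinkRisk 0 k₂ - shrinkRisk lam k₂) ∧
      shrinkRisk 0 k₂ - shrinkRisk lam k₂ < shrinkRisk lam k₁ - shrinkRisk 0 k₁ :=
  exists_max_regret_gain_of_moments hlam (integral_riskKernel_sq_pos hlam).le
    (integral_riskKernel_cubic_pos hlam)

/-! ### Reduction of the limit law to the shrinkage problem -/

lemma posSemidef_fin_two {a b c : ℝ} (h : ∀ x y : ℝ, 0 ≤ a * x ^ 2 + 2 * b * (x * y) + c * y ^ 2) :
    (!![a, b; b, c] : Matrix (Fin 2) (Fin 2) ℝ).PosSemidef := by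
  refine Matrix.PosSemidef.of_dotProduct_mulVec_nonneg ?_ fun x ↦ ?_
  · ext i j; fin_cases i <;> fin_cases j <;> simp
  · have := h (x 0) (x 1)
    simp only [Matrix.mulVec, dotProduct, Fin.sum_univ_two, Pi.star_apply, star_trivial,
      Matrix.of_apply, Matrix.cons_val_zero, Matrix.cons_val_one]
    simp
    linarith

section

variable {σC σE : ℝ}

lemma posSemidef_joint (hσ : σE ^ 2 < σC ^ 2) :
    (!![σC ^ 2, σE ^ 2; σE ^ 2, σE ^ 2] : Matrix (Fin 2) (Fin 2) ℝ).PosSemidef :=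
  posSemidef_fin_two fun x y ↦ by
    nlinarith [mul_nonneg (sub_pos.2 hσ).le (sq_nonneg x), mul_nonneg (sq_nonneg σE)
      (sq_nonneg (x + y))]

lemma posSemidef_VW (hσ : σE ^ 2 < σC ^ 2) :
    (!![σC ^ 2, -(σC ^ 2 - σE ^ 2); -(σC ^ 2 - σE ^ 2), σC ^ 2 - σE ^ 2] :
      Matrix (Fin 2) (Fin 2) ℝ).PosSemidef :=
  posSemidef_fin_two fun x y ↦ by
    nlinarith [mul_nonneg (sub_pos.2 hσ).le (sq_nonneg (x - y)), mul_nonneg (sq_nonneg σE)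
      (sq_nonneg x)]

instance (h : ℝ) : IsGaussian (lawVW σC σE h) := by unfold lawVW; infer_instance

lemma memLp_eval {μ : Measure (EuclideanSpace ℝ (Fin 2))} [IsGaussian μ] (i : Fin 2) :
    MemLp (fun x : EuclideanSpace ℝ (Fin 2) ↦ x i) 2 μ :=
  (EuclideanSpace.proj (𝕜 := ℝ) i).comp_memLp' IsGaussian.memLp_two_id

lemma measurable_limitU (σC σE lam : ℝ) : Measurable (limitU σC σE lam) := by
  unfold limitU; fun_prop

lemma memLp_limitU (hσ : σE ^ 2 < σC ^ 2) (h lam : ℝ) :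
    MemLp (limitU σC σE lam) 2 (lawVW σC σE h) := by
  refine (((memLp_eval 0).norm).add (memLp_eval 1).norm).mono'
    (measurable_limitU σC σE lam).aestronglyMeasurable (ae_of_all _ fun x ↦ ?_)
  have hs := sub_pos.2 hσ
  set s := σC ^ 2 - σE ^ 2
  have hm : 0 ≤ max 0 (x 1 ^ 2 - lam * s) := le_max_left _ _
  refine (norm_add_le _ _).trans (add_le_add le_rfl ?_)
  rw [norm_mul]
  refine mul_le_of_le_one_right (norm_nonneg _) ?_
  rw [Real.norm_of_nonneg (by positivity)]
  exact div_le_one_of_le₀ (by linarith) (by positivity)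

/-- The part of `limitU` which depends on `W` only, when `V` is replaced by `V + W - h`. -/
def shrinkPart (s h lam w : ℝ) : ℝ :=
  w * (s / (max 0 (w ^ 2 - lam * s) + s)) - (w - h)

lemma limitU_eq (h lam : ℝ) (x : EuclideanSpace ℝ (Fin 2)) :
    limitU σC σE lam x = (x 0 + x 1 - h) + shrinkPart (σC ^ 2 - σE ^ 2) h lam (x 1) := by
  simp only [limitU, shrinkPart]; ring

/-- Scaling: for `W = √s * w` with `w = h / √s + x`, one has `W² - lam s = s (w² - lam)`, and `s`
cancels in the weight. -/
lemma shrinkPart_normalized {s : ℝ} (hs : 0 < s) (h lam x : ℝ) :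
    shrinkPart s h lam (√s * x + h) = √s * (psi lam (h / √s + x) - x) := by
  have hs0 : 0 < √s := Real.sqrt_pos.2 hs
  have hss : √s ^ 2 = s := Real.sq_sqrt hs.le
  set w := h / √s + x with hw
  have hwx : √s * x + h = √s * w := by rw [hw]; field_simp; ring
  have hhx : h = √s * (w - x) := by rw [hw]; field_simp; ring
  have h1 : max 0 ((√s * w) ^ 2 - lam * s) = s * max 0 (w ^ 2 - lam) := by
    rw [mul_max_of_nonneg _ _ hs.le, mul_zero, mul_pow, hss]; congr 1; ring
  have h2 := psi_den_pos lam w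
  rw [shrinkPart, hwx, h1, psi, hhx]
  have h3 : s * max 0 (w ^ 2 - lam) + s = s * (1 + max 0 (w ^ 2 - lam)) := by ring
  rw [h3]
  generalize 1 + max 0 (w ^ 2 - lam) = d at *
  field_simp
  ring

lemma measurable_shrinkPart (s h lam : ℝ) : Measurable (shrinkPart s h lam) := by
  unfold shrinkPart; fun_prop

lemma gaussianReal_eq_map {s : ℝ} (hs : 0 < s) (h : ℝ) :
    gaussianReal h s.toNNReal = (gaussianReal 0 1).map fun x ↦ √s * x + h := by
  have h1 : (fun x ↦ √s * x + h) = (fun x ↦ x + h) ∘ fun x ↦ √s * x := rfl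
  rw [h1, ← Measure.map_map (by fun_prop) (by fun_prop), gaussianReal_map_const_mul,
    gaussianReal_map_add_const]
  congr 1
  · simp
  · ext; simp [Real.sq_sqrt hs.le, hs.le]

lemma integral_comp_eval_one (hσ : σE ^ 2 < σC ^ 2) (h : ℝ) {F : ℝ → ℝ} (hF : Measurable F) :
    ∫ x, F (x 1) ∂(lawVW σC σE h) =
      ∫ x, F (√(σC ^ 2 - σE ^ 2) * x + h) ∂(gaussianReal 0 1) := by
  have hmp := measurePreserving_eval_multivariateGaussian (posSemidef_VW hσ)
    (μ := !₂[0, h]) (i := 1)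
  have h1 : ∫ x, F (x 1) ∂(lawVW σC σE h) =
      ∫ y, F y ∂(gaussianReal h (σC ^ 2 - σE ^ 2).toNNReal) := by
    have : (lawVW σC σE h).map (fun x ↦ x 1) = gaussianReal h (σC ^ 2 - σE ^ 2).toNNReal :=
      hmp.map_eq
    rw [← this, integral_map hmp.measurable.aemeasurable hF.aestronglyMeasurable]
  rw [h1, gaussianReal_eq_map (sub_pos.2 hσ), integral_map (by fun_prop)
    hF.aestronglyMeasurable]

lemma integral_eval_add (hσ : σE ^ 2 < σC ^ 2) (h : ℝ) :
    ∫ x, (x 0 + x 1 - h) ∂(lawVW σC σE h) = 0 ∧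
      ∫ x, (x 0 + x 1 - h) ^ 2 ∂(lawVW σC σE h) = σE ^ 2 := by
  have hm (i : Fin 2) : ∫ x, x i ∂(lawVW σC σE h) = (!₂[0, h] : EuclideanSpace ℝ (Fin 2)) i := by
    have := (EuclideanSpace.proj (𝕜 := ℝ) i).integral_comp_id_comm
      (IsGaussian.integrable_id (μ := lawVW σC σE h))
    rw [show (∫ x, x ∂(lawVW σC σE h)) = !₂[0, h] from integral_id_multivariateGaussian] at this
    exact this
  have hi (i : Fin 2) : Integrable (fun x : EuclideanSpace ℝ (Fin 2) ↦ x i) (lawVW σC σE h) :=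
    (memLp_eval i).integrable one_le_two
  have hadd : Integrable (fun x : EuclideanSpace ℝ (Fin 2) ↦ x 0 + x 1) (lawVW σC σE h) :=
    (hi 0).add (hi 1)
  have hmean : ∫ x, (x 0 + x 1 - h) ∂(lawVW σC σE h) = 0 := by
    rw [integral_sub hadd (integrable_const _), integral_add (hi 0) (hi 1), hm, hm]
    simp
  refine ⟨hmean, ?_⟩
  have hsum : ∫ x, (x 0 + x 1) ∂(lawVW σC σE h) = h := by
    rw [integral_add (hi 0) (hi 1), hm, hm]; simp
  have hvar : Var[fun x : EuclideanSpace ℝ (Fin 2) ↦ x 0 + x 1; lawVW σC σE h] = σE ^ 2 := by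
    have := variance_add (memLp_eval (μ := lawVW σC σE h) 0) (memLp_eval 1)
    have e : ((fun x : EuclideanSpace ℝ (Fin 2) ↦ x 0) + fun x ↦ x 1) = fun x ↦ x 0 + x 1 := rfl
    rw [e] at this
    rw [this, lawVW, variance_eval_multivariateGaussian (posSemidef_VW hσ),
      variance_eval_multivariateGaussian (posSemidef_VW hσ),
      covariance_eval_multivariateGaussian (posSemidef_VW hσ)]
    simp
    ring
  rw [variance_eq_integral hadd.aemeasurable, hsum] at hvar
  exact hvar

/-- The covariance of `V + W` and `W` is `-(σC² - σE²) + (σC² - σE²) = 0`, which implies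
independence for a Gaussian vector. -/
lemma indepFun_eval_add (hσ : σE ^ 2 < σC ^ 2) (h : ℝ) :
    IndepFun (fun x : EuclideanSpace ℝ (Fin 2) ↦ x 0 + x 1) (fun x ↦ x 1) (lawVW σC σE h) := by
  have hid : HasGaussianLaw (id : EuclideanSpace ℝ (Fin 2) → _) (lawVW σC σE h) :=
    ⟨by rw [Measure.map_id]; infer_instance⟩
  refine HasGaussianLaw.indepFun_of_covariance_eq_zero
    (hid.map (((EuclideanSpace.proj (𝕜 := ℝ) (0 : Fin 2)) +
      EuclideanSpace.proj (1 : Fin 2)).prod (EuclideanSpace.proj (1 : Fin 2)))) ?_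
  have := covariance_add_left (memLp_eval (μ := lawVW σC σE h) 0) (memLp_eval 1) (memLp_eval 1)
  have e : ((fun x : EuclideanSpace ℝ (Fin 2) ↦ x 0) + fun x ↦ x 1) = fun x ↦ x 0 + x 1 := rfl
  rw [e] at this
  rw [this, lawVW, covariance_eval_multivariateGaussian (posSemidef_VW hσ),
    covariance_eval_multivariateGaussian (posSemidef_VW hσ)]
  simp

lemma memLp_shrinkPart (hσ : σE ^ 2 < σC ^ 2) (h lam : ℝ) :
    MemLp (fun x : EuclideanSpace ℝ (Fin 2) ↦ shrinkPart (σC ^ 2 - σE ^ 2) h lam (x 1)) 2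
      (lawVW σC σE h) := by
  have h1 := (memLp_limitU hσ h lam).sub (((memLp_eval 0).add (memLp_eval 1)).sub (memLp_const h))
  refine h1.congr_norm ((measurable_shrinkPart _ h lam).comp (by fun_prop)).aestronglyMeasurable
    (ae_of_all _ fun x ↦ ?_)
  simp [limitU_eq h]

/-- The risk of the limit law, in terms of the normalized shrinkage problem. -/
lemma risk_eq (hσ : σE ^ 2 < σC ^ 2) (h lam : ℝ) :
    risk σC σE h lam =
      σE ^ 2 + (σC ^ 2 - σE ^ 2) * shrinkRisk lam (h / √(σC ^ 2 - σE ^ 2)) := by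
  have hs := sub_pos.2 hσ
  have hA : MemLp (fun x : EuclideanSpace ℝ (Fin 2) ↦ x 0 + x 1 - h) 2 (lawVW σC σE h) :=
    ((memLp_eval 0).add (memLp_eval 1)).sub (memLp_const h)
  have hB := memLp_shrinkPart hσ h lam
  -- The cross term vanishes by independence, because the first factor is centred.
  have hind : ∫ x, (x 0 + x 1 - h) * shrinkPart (σC ^ 2 - σE ^ 2) h lam (x 1) ∂(lawVW σC σE h) =
      0 := by
    have := ((indepFun_eval_add hσ h).comp (φ := fun y ↦ y - h) (by fun_prop)
      (measurable_shrinkPart (σC ^ 2 - σE ^ 2) h lam)).integral_fun_mul_eq_mul_integral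
        hA.aestronglyMeasurable hB.aestronglyMeasurable
    simp only [Function.comp_apply] at this
    rw [this, (integral_eval_add hσ h).1, zero_mul]
  have hexp : risk σC σE h lam = ∫ x, ((x 0 + x 1 - h) ^ 2 +
      2 * ((x 0 + x 1 - h) * shrinkPart (σC ^ 2 - σE ^ 2) h lam (x 1))) +
        shrinkPart (σC ^ 2 - σE ^ 2) h lam (x 1) ^ 2 ∂(lawVW σC σE h) := by
    unfold risk
    congr 1 with x
    rw [limitU_eq h]
    ring
  have hAB : Integrable (fun x : EuclideanSpace ℝ (Fin 2) ↦
      2 * ((x 0 + x 1 - h) * shrinkPart (σC ^ 2 - σE ^ 2) h lam (x 1))) (lawVW σC σE h) :=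
    (hA.integrable_mul hB).const_mul 2
  have hA2AB : Integrable (fun x : EuclideanSpace ℝ (Fin 2) ↦ (x 0 + x 1 - h) ^ 2 +
      2 * ((x 0 + x 1 - h) * shrinkPart (σC ^ 2 - σE ^ 2) h lam (x 1))) (lawVW σC σE h) :=
    hA.integrable_sq.add hAB
  rw [hexp, integral_add hA2AB hB.integrable_sq,
    integral_add hA.integrable_sq hAB, integral_const_mul]
  have h2 : ∫ x, shrinkPart (σC ^ 2 - σE ^ 2) h lam (x 1) ^ 2 ∂(lawVW σC σE h) =
      (σC ^ 2 - σE ^ 2) * shrinkRisk lam (h / √(σC ^ 2 - σE ^ 2)) := by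
    rw [integral_comp_eval_one hσ h ((measurable_shrinkPart _ h lam).pow_const 2), shrinkRisk,
      ← integral_const_mul]
    congr 1 with x
    rw [shrinkPart_normalized hs, mul_pow, Real.sq_sqrt hs.le]
    ring
  rw [h2, (integral_eval_add hσ h).2, hind]
  ring

/-- At `h = 0` the part depending on `W` is an odd function of a symmetric variable. -/
lemma integral_limitU (hσ : σE ^ 2 < σC ^ 2) (lam : ℝ) :
    ∫ x, limitU σC σE lam x ∂(lawVW σC σE 0) = 0 := by
  have hs := sub_pos.2 hσ
  have hA : MemLp (fun x : EuclideanSpace ℝ (Fin 2) ↦ x 0 + x 1 - 0) 2 (lawVW σC σE 0) :=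
    ((memLp_eval 0).add (memLp_eval 1)).sub (memLp_const 0)
  have hB := memLp_shrinkPart hσ 0 lam
  simp_rw [limitU_eq 0]
  rw [integral_add (hA.integrable one_le_two) (hB.integrable one_le_two),
    (integral_eval_add hσ 0).1, zero_add,
    integral_comp_eval_one hσ 0 (measurable_shrinkPart _ 0 lam)]
  have h1 := integral_gaussian_neg fun x ↦
    shrinkPart (σC ^ 2 - σE ^ 2) 0 lam (√(σC ^ 2 - σE ^ 2) * x + 0)
  simp_rw [shrinkPart_normalized hs, zero_div, zero_add, psi_neg] at h1 ⊢
  have h2 (x : ℝ) : √(σC ^ 2 - σE ^ 2) * (-psi lam x - -x) =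
      -(√(σC ^ 2 - σE ^ 2) * (psi lam x - x)) := by ring
  simp_rw [h2, integral_neg] at h1
  linarith

lemma variance_limitU (hσ : σE ^ 2 < σC ^ 2) (lam : ℝ) :
    Var[limitU σC σE lam; lawVW σC σE 0] = σE ^ 2 + (σC ^ 2 - σE ^ 2) * shrinkRisk lam 0 := by
  rw [variance_of_integral_eq_zero (measurable_limitU σC σE lam).aemeasurable
    (integral_limitU hσ lam)]
  have := risk_eq hσ 0 lam
  rwa [zero_div] at this

lemma strictAnti_variance_limitU (hσ : σE ^ 2 < σC ^ 2) :
    StrictAnti fun lam : ℝ ↦ Var[limitU σC σE lam; lawVW σC σE 0] := by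
  intro a b hab
  simp only [variance_limitU hσ]
  have := mul_lt_mul_of_pos_left (strictAnti_shrinkRisk_zero hab) (sub_pos.2 hσ)
  simp only at this
  linarith

lemma tendsto_variance_limitU (hσ : σE ^ 2 < σC ^ 2) :
    Tendsto (fun lam : ℝ ↦ Var[limitU σC σE lam; lawVW σC σE 0]) atTop (𝓝 (σE ^ 2)) := by
  simp only [variance_limitU hσ]
  simpa using (tendsto_shrinkRisk_zero.const_mul (σC ^ 2 - σE ^ 2)).const_add (σE ^ 2)

lemma exists_max_regret_gt_max_gain (hσ : σE ^ 2 < σC ^ 2) {lam : ℝ} (hlam : 0 < lam) :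
    ∃ maxRegret maxGain : ℝ,
      IsGreatest (Set.range fun h : ℝ ↦ risk σC σE h lam - risk σC σE h 0) maxRegret ∧
      IsGreatest (Set.range fun h : ℝ ↦ risk σC σE h 0 - risk σC σE h lam) maxGain ∧
      maxGain < maxRegret := by
  have hs := sub_pos.2 hσ
  have hs0 : √(σC ^ 2 - σE ^ 2) ≠ 0 := (Real.sqrt_pos.2 hs).ne'
  obtain ⟨k₁, k₂, h1, h2, h3⟩ := exists_max_regret_gain hlam
  have hsub (a b h : ℝ) : risk σC σE h a - risk σC σE h b = (σC ^ 2 - σE ^ 2) *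
      (shrinkRisk a (h / √(σC ^ 2 - σE ^ 2)) - shrinkRisk b (h / √(σC ^ 2 - σE ^ 2))) := by
    rw [risk_eq hσ, risk_eq hσ]; ring
  refine ⟨(σC ^ 2 - σE ^ 2) * (shrinkRisk lam k₁ - shrinkRisk 0 k₁),
    (σC ^ 2 - σE ^ 2) * (shrinkRisk 0 k₂ - shrinkRisk lam k₂), ⟨⟨k₁ * √(σC ^ 2 - σE ^ 2), ?_⟩, ?_⟩,
    ⟨⟨k₂ * √(σC ^ 2 - σE ^ 2), ?_⟩, ?_⟩, mul_lt_mul_of_pos_left h3 hs⟩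
  · simp only [hsub, mul_div_cancel_right₀ _ hs0]
  · rintro _ ⟨h, rfl⟩
    simp only [hsub]
    exact mul_le_mul_of_nonneg_left (h1 _) hs.le
  · simp only [hsub, mul_div_cancel_right₀ _ hs0]
  · rintro _ ⟨h, rfl⟩
    simp only [hsub]
    exact mul_le_mul_of_nonneg_left (h2 _) hs.le

end

/-! ### Convergence in distribution on varying probability spaces -/

section

variable {ι E : Type*} {Ω Ω₁ : ι → Type*} {m : ∀ i, MeasurableSpace (Ω i)}
  {m₁ : ∀ i, MeasurableSpace (Ω₁ i)} {μ : (i : ι) → Measure (Ω i)} [∀ i, IsProbabilityMeasure (μ i)]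
  {μ₁ : (i : ι) → Measure (Ω₁ i)} [∀ i, IsProbabilityMeasure (μ₁ i)]
  {Ω' Ω₁' : Type*} {m' : MeasurableSpace Ω'} {μ' : Measure Ω'} [IsProbabilityMeasure μ']
  {m₁' : MeasurableSpace Ω₁'} {μ₁' : Measure Ω₁'} [IsProbabilityMeasure μ₁']
  {l : Filter ι}

/-- Convergence in distribution depends on the laws only. -/
lemma tendstoInDistribution_congr_law [TopologicalSpace E] [MeasurableSpace E]
    [OpensMeasurableSpace E] {X : (i : ι) → Ω i → E}
    {X₁ : (i : ι) → Ω₁ i → E} {Z : Ω' → E} {Z₁ : Ω₁' → E}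
    (h : TendstoInDistribution X l Z μ μ') (hX₁ : ∀ i, AEMeasurable (X₁ i) (μ₁ i))
    (hZ₁ : AEMeasurable Z₁ μ₁') (hX : ∀ i, (μ₁ i).map (X₁ i) = (μ i).map (X i))
    (hZ : μ₁'.map Z₁ = μ'.map Z) : TendstoInDistribution X₁ l Z₁ μ₁ μ₁' := by
  refine ⟨hX₁, hZ₁, ?_⟩
  have h2 := h.tendsto
  have e1 : (fun i ↦ (⟨(μ₁ i).map (X₁ i), Measure.isProbabilityMeasure_map (hX₁ i)⟩ :
      ProbabilityMeasure E)) = fun i ↦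
        ⟨(μ i).map (X i), Measure.isProbabilityMeasure_map (h.forall_aemeasurable i)⟩ :=
    funext fun i ↦ Subtype.ext (hX i)
  have e2 : (⟨μ₁'.map Z₁, Measure.isProbabilityMeasure_map hZ₁⟩ : ProbabilityMeasure E) =
      ⟨μ'.map Z, Measure.isProbabilityMeasure_map h.aemeasurable_limit⟩ := Subtype.ext hZ
  rw [e1, e2]
  exact h2

end

section

variable {Ω : ℕ → Type*} [∀ n, MeasurableSpace (Ω n)] {P : (n : ℕ) → Measure (Ω n)}
  {X Y : (n : ℕ) → Ω n → ℝ} {a b : ℝ}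

lemma TendstoInProbConst.congr_of_eventually (hX : TendstoInProbConst P X a)
    (h : ∀ᶠ n in atTop, ∀ ω, X n ω = Y n ω) : TendstoInProbConst P Y a := fun ε hε ↦ by
  refine (hX ε hε).congr' ?_
  filter_upwards [h] with n hn
  simp [hn]

lemma TendstoInProbConst.add (hX : TendstoInProbConst P X a) (hY : TendstoInProbConst P Y b) :
    TendstoInProbConst P (fun n ω ↦ X n ω + Y n ω) (a + b) := fun ε hε ↦ by
  have h := (hX (ε / 2) (half_pos hε)).add (hY (ε / 2) (half_pos hε))
  rw [add_zero] at h
  refine tendsto_of_tendsto_of_tendsto_of_le_of_le tendsto_const_nhds h (fun _ ↦ zero_le)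
    fun n ↦ (measure_mono fun ω hω ↦ ?_).trans (measure_union_le _ _)
  simp only [Set.mem_union, Set.mem_ofPred_eq] at hω ⊢
  by_contra! hlt
  have := abs_add_le (X n ω - a) (Y n ω - b)
  rw [show X n ω - a + (Y n ω - b) = X n ω + Y n ω - (a + b) by ring] at this
  linarith

lemma TendstoInProbConst.neg (hX : TendstoInProbConst P X a) :
    TendstoInProbConst P (fun n ω ↦ -X n ω) (-a) := fun ε hε ↦ by
  refine (hX ε hε).congr fun n ↦ ?_
  congr 1 with ω
  simp only [Set.mem_ofPred_eq]
  rw [← abs_neg, neg_sub, sub_neg_eq_add, neg_add_eq_sub]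

lemma TendstoInProbConst.sub (hX : TendstoInProbConst P X a) (hY : TendstoInProbConst P Y b) :
    TendstoInProbConst P (fun n ω ↦ X n ω - Y n ω) (a - b) := by
  simpa only [sub_eq_add_neg] using hX.add hY.neg

lemma TendstoInProbConst.of_tendsto {r : ℕ → ℝ} (hr : Tendsto r atTop (𝓝 a)) :
    TendstoInProbConst P (fun n _ ↦ r n) a := fun ε hε ↦ by
  refine tendsto_const_nhds.congr' ?_
  filter_upwards [Metric.tendsto_nhds.1 hr ε hε] with n hn
  rw [Real.dist_eq] at hn
  simp [not_le.2 hn]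

lemma TendstoInProbConst.tendsto_measure_lt (hX : TendstoInProbConst P X a) (hba : b < a) :
    Tendsto (fun n ↦ P n {ω | X n ω < b}) atTop (𝓝 0) := by
  refine tendsto_of_tendsto_of_tendsto_of_le_of_le tendsto_const_nhds (hX _ (sub_pos.2 hba))
    (fun _ ↦ zero_le) fun n ↦ measure_mono fun ω (hω : X n ω < b) ↦ ?_
  simp only [Set.mem_ofPred_eq]
  rw [abs_sub_comm]
  exact le_trans (by linarith) (le_abs_self _)

section

variable [∀ n, IsProbabilityMeasure (P n)] {Ω' : Type*} {m' : MeasurableSpace Ω'}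
  {μ' : Measure Ω'} [IsProbabilityMeasure μ']

lemma aemeasurable_comp_eval {F : Type*} [MeasurableSpace F] {T : (n : ℕ) → Ω n → F}
    (hT : ∀ n, AEMeasurable (T n) (P n)) (n : ℕ) :
    AEMeasurable (fun ω : (n : ℕ) → Ω n ↦ T n (ω n)) (Measure.infinitePi P) :=
  (hT n).comp_quasiMeasurePreserving (measurePreserving_eval_infinitePi P n).quasiMeasurePreserving

lemma map_comp_eval {F : Type*} [MeasurableSpace F] {T : (n : ℕ) → Ω n → F}
    (hT : ∀ n, AEMeasurable (T n) (P n)) (n : ℕ) :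
    (Measure.infinitePi P).map (fun ω ↦ T n (ω n)) = (P n).map (T n) := by
  have hmp := measurePreserving_eval_infinitePi P n
  have := AEMeasurable.map_map_of_aemeasurable (μ := Measure.infinitePi P)
    (f := Function.eval n) (g := T n) (by rw [hmp.map_eq]; exact hT n) hmp.measurable.aemeasurable
  rw [hmp.map_eq] at this
  exact this.symm

/-- **Slutsky's theorem** on probability spaces that vary with `n`. -/
lemma tendstoInDistribution_prodMk {E : Type*} [SeminormedAddCommGroup E]
    [SecondCountableTopology E] [MeasurableSpace E] [BorelSpace E] {X : (n : ℕ) → Ω n → E}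
    {Z : Ω' → E} (hX : TendstoInDistribution X atTop Z P μ') (hY : TendstoInProbConst P Y b)
    (hYm : ∀ n, AEMeasurable (Y n) (P n)) :
    TendstoInDistribution (fun n ω ↦ (X n ω, Y n ω)) atTop (fun ω ↦ (Z ω, b)) P μ' := by
  have hmp (n : ℕ) : MeasurePreserving (Function.eval n) (Measure.infinitePi P) (P n) :=
    measurePreserving_eval_infinitePi P n
  have hXm := hX.forall_aemeasurable
  -- The samples are moved to the product of all the sample spaces, which keeps the law of each and
  -- puts them on one probability space.
  have h1 : TendstoInDistribution (fun n (ω : (n : ℕ) → Ω n) ↦ X n (ω n)) atTop Z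
      (fun _ ↦ Measure.infinitePi P) μ' :=
    tendstoInDistribution_congr_law hX (aemeasurable_comp_eval hXm) hX.aemeasurable_limit
      (map_comp_eval hXm) rfl
  have h2 : TendstoInMeasure (Measure.infinitePi P) (fun n (ω : (n : ℕ) → Ω n) ↦ Y n (ω n)) atTop
      fun _ ↦ b := by
    rw [tendstoInMeasure_iff_norm]
    intro ε hε
    refine tendsto_of_tendsto_of_tendsto_of_le_of_le tendsto_const_nhds (hY ε hε)
      (fun _ ↦ zero_le) fun n ↦ ?_
    -- Since `Y n` is only almost everywhere measurable, this event need not be measurable; the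
    -- inequality suffices.
    have := Measure.le_map_apply (μ := Measure.infinitePi P) (hmp n).measurable.aemeasurable
      {ω | ε ≤ |Y n ω - b|}
    rw [(hmp n).map_eq] at this
    exact this
  have h3 := h1.prodMk_of_tendstoInMeasure_const _ _ _ h2 (aemeasurable_comp_eval hYm)
  have hpair (n : ℕ) : AEMeasurable (fun ω ↦ (X n ω, Y n ω)) (P n) := (hXm n).prodMk (hYm n)
  exact tendstoInDistribution_congr_law h3 hpair h3.aemeasurable_limit
    (fun n ↦ (map_comp_eval hpair n).symm) rfl

/-- A sequence which differs from a convergent one on events of vanishing probability only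
converges to the same limit in distribution. -/
lemma tendstoInDistribution_of_tendsto_measure_ne {Z : Ω' → ℝ}
    (hX : TendstoInDistribution X atTop Z P μ') (hY : ∀ n, AEMeasurable (Y n) (P n))
    (h : Tendsto (fun n ↦ P n {ω | Y n ω ≠ X n ω}) atTop (𝓝 0)) :
    TendstoInDistribution Y atTop Z P μ' := by
  have hD : TendstoInProbConst P (fun n ω ↦ Y n ω - X n ω) 0 := fun ε hε ↦ by
    refine tendsto_of_tendsto_of_tendsto_of_le_of_le tendsto_const_nhds h
      (fun _ ↦ zero_le) fun n ↦ measure_mono fun ω (hω : ε ≤ |Y n ω - X n ω - 0|) heq ↦ ?_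
    rw [heq, sub_self, sub_zero, abs_zero] at hω
    exact hω.not_gt hε
  have h1 := (tendstoInDistribution_prodMk hX hD
    fun n ↦ (hY n).sub (hX.forall_aemeasurable n)).continuous_comp
      (g := fun x : ℝ × ℝ ↦ x.1 + x.2) (by fun_prop)
  convert h1 using 1
  · ext n ω; simp
  · ext ω; simp

/-- Portmanteau: the boundary point `b` of the half-line carries no mass of the Dirac measure at
`a`. -/
lemma tendsto_measure_lt_of_tendstoInDistribution
    (hX : TendstoInDistribution X atTop (fun _ ↦ a) P μ') (hba : b < a) :
    Tendsto (fun n ↦ P n {ω | X n ω < b}) atTop (𝓝 0) := by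
  have hd : μ'.map (fun _ ↦ a) = Measure.dirac a := by simp
  have h1 := ProbabilityMeasure.tendsto_measure_of_null_frontier_of_tendsto' hX.tendsto
    (E := Set.Iio b) (by
      simp only [ProbabilityMeasure.coe_mk, hd, frontier_Iio]
      simp [hba.ne'])
  simp only [ProbabilityMeasure.coe_mk, hd] at h1
  rw [Measure.dirac_apply' _ measurableSet_Iio, Set.indicator_of_notMem (by simp [hba.le])] at h1
  refine h1.congr fun n ↦ ?_
  rw [Measure.map_apply_of_aemeasurable (hX.forall_aemeasurable n) measurableSet_Iio]
  rfl

end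

end

/-! ### Limit laws of the combined estimator -/

/-- The random vector `(V, W_h)` as a function of the limit of the normalized estimators. -/
def toVW (h : ℝ) (x : EuclideanSpace ℝ (Fin 2)) : EuclideanSpace ℝ (Fin 2) :=
  !₂[x 0, x 1 - x 0 + h]

lemma measurable_toVW (h : ℝ) : Measurable (toVW h) := by
  unfold toVW
  have : Continuous fun x : EuclideanSpace ℝ (Fin 2) ↦
      (!₂[x 0, x 1 - x 0 + h] : EuclideanSpace ℝ (Fin 2)) := by fun_prop
  exact this.measurable

/-- Comparison of characteristic functions; the linear part of `toVW` is moved to its adjoint acting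
on `t`. -/
lemma map_toVW_jointLaw {σC σE : ℝ} (hσ : σE ^ 2 < σC ^ 2) (h : ℝ) :
    (jointLaw σC σE).map (toVW h) = lawVW σC σE h := by
  have := Measure.isProbabilityMeasure_map (μ := jointLaw σC σE) (measurable_toVW h).aemeasurable
  refine Measure.ext_of_charFun (funext fun t ↦ ?_)
  have e (x : EuclideanSpace ℝ (Fin 2)) : (inner ℝ (toVW h x) t : ℝ) =
      h * t 1 + inner ℝ x (!₂[t 0 - t 1, t 1] : EuclideanSpace ℝ (Fin 2)) := by
    simp [toVW, PiLp.inner_apply, Fin.sum_univ_two]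
    ring
  rw [charFun_apply, integral_map (measurable_toVW h).aemeasurable
    (Measurable.aestronglyMeasurable (by fun_prop))]
  simp_rw [e, Complex.ofReal_add, add_mul, Complex.exp_add]
  rw [integral_const_mul, ← charFun_apply, jointLaw, lawVW,
    charFun_multivariateGaussian (posSemidef_joint hσ),
    charFun_multivariateGaussian (posSemidef_VW hσ), ← Complex.exp_add]
  congr 1
  simp [PiLp.inner_apply, Fin.sum_univ_two, Matrix.mulVec, dotProduct]
  ring

section

variable {Ω : ℕ → Type*} [∀ n, MeasurableSpace (Ω n)] {P : (n : ℕ) → Measure (Ω n)}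
  {S : Statistics Ω} {lam : ℝ} {p : (n : ℕ) → Ω n → ℝ}

/-- The criterion is a quadratic in `p` with leading coefficient the denominator, positive as `vDiff
> 0`. A minimizer thus exists, so `isMin` applies, and it is unique. -/
lemma IsOptimalWeight.eq_div (hp : IsOptimalWeight P S lam p) {n : ℕ} {ω : Ω n}
    (hd : 0 < S.vDiff n ω) :
    p n ω = (S.vC n ω - S.cCE n ω) /
      (max 0 ((S.bE n ω - S.bC n ω) ^ 2 - lam * S.vDiff n ω) + S.vDiff n ω) := by
  set A := max 0 ((S.bE n ω - S.bC n ω) ^ 2 - lam * S.vDiff n ω) + S.vDiff n ω with hA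
  have hA0 : 0 < A := add_pos_of_nonneg_of_pos (le_max_left _ _) hd
  set q := (S.vC n ω - S.cCE n ω) / A with hq
  have hqA : A * q = S.vC n ω - S.cCE n ω := mul_div_cancel₀ _ hA0.ne'
  have hsq (r : ℝ) : estimatedMSE S lam n ω r = estimatedMSE S lam n ω q + A * (r - q) ^ 2 := by
    have e (t : ℝ) : estimatedMSE S lam n ω t = A * t ^ 2 - 2 * (A * q) * t + S.vC n ω := by
      rw [hqA, hA, estimatedMSE, Statistics.vDiff]; ring
    rw [e, e]; ring
  have hmin (r : ℝ) : estimatedMSE S lam n ω q ≤ estimatedMSE S lam n ω r := by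
    rw [hsq r]; nlinarith [mul_nonneg hA0.le (sq_nonneg (r - q))]
  have hle := hp.isMin n ω ⟨q, hmin⟩ q
  rw [hsq (p n ω)] at hle
  have h0 : (p n ω - q) ^ 2 ≤ 0 := by
    by_contra! h
    nlinarith [mul_pos hA0 h]
  exact sub_eq_zero.1 (pow_eq_zero_iff two_ne_zero |>.1 (le_antisymm h0 (sq_nonneg _)))

/-- Numerator and denominator of the weight are both multiplied by `n`, so that only normalized
statistics appear. -/
lemma sqrt_mul_combined_sub (hp : IsOptimalWeight P S lam p) {n : ℕ} (hn : 1 ≤ n) {ω : Ω n}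
    (hd : 0 < n * S.vDiff n ω) (b : ℝ) :
    √(n : ℝ) * (combined S p n ω - b) = √(n : ℝ) * (S.bC n ω - b) +
      √(n : ℝ) * (S.bE n ω - S.bC n ω) * (n * (S.vC n ω - S.cCE n ω) /
        (max 0 ((√(n : ℝ) * (S.bE n ω - S.bC n ω)) ^ 2 - lam * (n * S.vDiff n ω)) +
          n * S.vDiff n ω)) := by
  have hn0 : (0 : ℝ) < n := by exact_mod_cast hn
  have h1 : max 0 ((√(n : ℝ) * (S.bE n ω - S.bC n ω)) ^ 2 - lam * (n * S.vDiff n ω)) +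
      n * S.vDiff n ω =
      n * (max 0 ((S.bE n ω - S.bC n ω) ^ 2 - lam * S.vDiff n ω) + S.vDiff n ω) := by
    rw [mul_add, mul_max_of_nonneg _ _ hn0.le, mul_zero, mul_pow, Real.sq_sqrt hn0.le]
    congr 2; ring
  rw [h1, mul_div_mul_left _ _ hn0.ne', ← hp.eq_div (pos_of_mul_pos_right hd hn0.le), combined]
  ring

variable [∀ n, IsProbabilityMeasure (P n)] {β₀ βE : ℕ → ℝ} {σC σE : ℝ}

lemma aemeasurable_combined (hS : Setup P S β₀ βE σC σE) (hp : IsOptimalWeight P S lam p) (n : ℕ) :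
    AEMeasurable (fun ω : Ω n ↦ √(n : ℝ) * (combined S p n ω - β₀ n)) (P n) := by
  have := hS.bC_aemeasurable n
  have := hS.bE_aemeasurable n
  have := hp.aemeasurable n
  unfold combined
  fun_prop

lemma Setup.tendsto_vC_sub_cCE (hS : Setup P S β₀ βE σC σE) :
    TendstoInProbConst P (fun n ω ↦ n * (S.vC n ω - S.cCE n ω)) (σC ^ 2 - σE ^ 2) := by
  simpa only [mul_sub] using hS.vC_consistent.sub hS.cCE_consistent

lemma Setup.tendsto_vDiff (hS : Setup P S β₀ βE σC σE) :
    TendstoInProbConst P (fun n ω ↦ n * S.vDiff n ω) (σC ^ 2 - σE ^ 2) := by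
  have h := (hS.vE_consistent.sub hS.cCE_consistent).add hS.tendsto_vC_sub_cCE
  rw [sub_self, zero_add] at h
  refine h.congr_of_eventually (Eventually.of_forall fun n ω ↦ ?_)
  rw [Statistics.vDiff]; ring

lemma Setup.tendsto_joint (hS : Setup P S β₀ βE σC σE) :
    TendstoInDistribution (fun (n : ℕ) (ω : Ω n) ↦
      (((!₂[√(n : ℝ) * (S.bC n ω - β₀ n), √(n : ℝ) * (S.bE n ω - βE n)] :
        EuclideanSpace ℝ (Fin 2)), n * (S.vC n ω - S.cCE n ω)), n * S.vDiff n ω))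
      atTop (fun x ↦ ((x, σC ^ 2 - σE ^ 2), σC ^ 2 - σE ^ 2)) P (jointLaw σC σE) := by
  refine tendstoInDistribution_prodMk (tendstoInDistribution_prodMk hS.asymptotic_normality
    hS.tendsto_vC_sub_cCE fun n ↦ ?_) hS.tendsto_vDiff fun n ↦ ?_
  · have := hS.vC_aemeasurable n
    have := hS.cCE_aemeasurable n
    fun_prop
  · have := hS.vC_aemeasurable n
    have := hS.vE_aemeasurable n
    have := hS.cCE_aemeasurable n
    unfold Statistics.vDiff
    fun_prop

/-- The normalized combined estimator as a function of the normalized statistics, under local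
alternatives; `δ` is a positive lower bound which keeps the denominator away from zero. -/
def localMap (h lam δ : ℝ) (q : (EuclideanSpace ℝ (Fin 2) × ℝ) × ℝ) : ℝ :=
  q.1.1 0 + (q.1.1 1 - q.1.1 0 + h) * (q.1.2 /
    (max 0 ((q.1.1 1 - q.1.1 0 + h) ^ 2 - lam * q.2) + max q.2 δ))

lemma continuous_localMap (h lam : ℝ) {δ : ℝ} (hδ : 0 < δ) : Continuous (localMap h lam δ) := by
  unfold localMap
  refine Continuous.add (by fun_prop) (Continuous.mul (by fun_prop)
    (Continuous.div₀ (by fun_prop) (by fun_prop) fun q ↦ ?_))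
  exact (add_pos_of_nonneg_of_pos (le_max_left _ _) (lt_max_of_lt_right hδ)).ne'

/-- The limit law under local alternatives. -/
theorem tendsto_combined_local (hS : Setup P S β₀ βE σC σE) (hp : IsOptimalWeight P S lam p)
    {h : ℝ} (hβ : ∀ n : ℕ, 1 ≤ n → βE n = β₀ n + h / √(n : ℝ)) :
    TendstoInDistribution (fun (n : ℕ) (ω : Ω n) ↦ √(n : ℝ) * (combined S p n ω - β₀ n))
      atTop (limitU σC σE lam) P (lawVW σC σE h) := by
  have hs : 0 < σC ^ 2 - σE ^ 2 := sub_pos.2 hS.variance_lt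
  -- Half the limit of `n * vDiff`: the truncation at `δ` is inactive with probability tending to
  -- one and at the limit.
  set δ := (σC ^ 2 - σE ^ 2) / 2 with hδ
  have hδ0 : 0 < δ := half_pos hs
  have hδs : δ < σC ^ 2 - σE ^ 2 := half_lt_self hs
  have h1 := hS.tendsto_joint.continuous_comp (continuous_localMap h lam hδ0)
  have h2 := tendstoInDistribution_of_tendsto_measure_ne h1 (aemeasurable_combined hS hp) (by
    refine tendsto_of_tendsto_of_tendsto_of_le_of_le' tendsto_const_nhds
      (hS.tendsto_vDiff.tendsto_measure_lt hδs) (Eventually.of_forall fun _ ↦ zero_le) ?_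
    filter_upwards [eventually_ge_atTop 1] with n hn
    refine measure_mono fun ω hω ↦ ?_
    by_contra! hlt
    simp only [Set.mem_ofPred_eq, not_lt] at hlt
    refine hω ?_
    have hn0 : (0 : ℝ) < √(n : ℝ) := Real.sqrt_pos.2 (by exact_mod_cast hn)
    have hW : √(n : ℝ) * (S.bE n ω - βE n) - √(n : ℝ) * (S.bC n ω - β₀ n) + h =
        √(n : ℝ) * (S.bE n ω - S.bC n ω) := by
      rw [hβ n hn]; field_simp; ring
    rw [sqrt_mul_combined_sub hp hn (hδ0.trans_le hlt)]
    simp only [Function.comp_apply, localMap, Matrix.cons_val_zero,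
      Matrix.cons_val_one, hW, max_eq_left hlt])
  refine tendstoInDistribution_congr_law h2 h2.forall_aemeasurable
    (measurable_limitU σC σE lam).aemeasurable (fun _ ↦ rfl) ?_
  rw [← map_toVW_jointLaw hS.variance_lt, Measure.map_map (measurable_limitU σC σE lam)
    (measurable_toVW h)]
  congr 1
  ext x
  simp [localMap, limitU, toVW, max_eq_left hδs.le]

/-- The denominator of the optimal weight under a fixed alternative, divided by `n`; the last
coordinate stands for `1 / √n`. -/
def fixedDen (Δ lam : ℝ) (q : ((EuclideanSpace ℝ (Fin 2) × ℝ) × ℝ) × ℝ) : ℝ :=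
  max 0 ((Δ + q.2 * (q.1.1.1 1 - q.1.1.1 0)) ^ 2 - lam * (q.1.2 * q.2 ^ 2)) + q.1.2 * q.2 ^ 2

/-- The normalized combined estimator as a function of the normalized statistics, under a fixed
alternative. -/
def fixedMap (Δ lam : ℝ) (q : ((EuclideanSpace ℝ (Fin 2) × ℝ) × ℝ) × ℝ) : ℝ :=
  q.1.1.1 0 + q.2 * (Δ + q.2 * (q.1.1.1 1 - q.1.1.1 0)) * q.1.1.2 /
    max (fixedDen Δ lam q) (Δ ^ 2 / 2)

lemma continuous_fixedDen (Δ lam : ℝ) : Continuous (fixedDen Δ lam) := by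
  unfold fixedDen; fun_prop

lemma continuous_fixedMap {Δ : ℝ} (hΔ : Δ ≠ 0) (lam : ℝ) : Continuous (fixedMap Δ lam) := by
  have := continuous_fixedDen Δ lam
  unfold fixedMap
  refine Continuous.add (by fun_prop) (Continuous.div₀ (by fun_prop) (by fun_prop) fun q ↦ ?_)
  exact (lt_max_of_lt_right (by positivity)).ne'

/-- Asymptotic normality under a fixed alternative. -/
theorem tendsto_combined_fixed (hS : Setup P S β₀ βE σC σE) (hp : IsOptimalWeight P S lam p)
    {Δ : ℝ} (hΔ : Δ ≠ 0) (hβ : ∀ n, βE n = β₀ n + Δ) :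
    TendstoInDistribution (fun (n : ℕ) (ω : Ω n) ↦ √(n : ℝ) * (combined S p n ω - β₀ n))
      atTop id P (gaussianReal 0 (σC ^ 2).toNNReal) := by
  have hs : 0 < σC ^ 2 - σE ^ 2 := sub_pos.2 hS.variance_lt
  have hr : Tendsto (fun n : ℕ ↦ (√(n : ℝ))⁻¹) atTop (𝓝 0) :=
    tendsto_inv_atTop_zero.comp (Real.tendsto_sqrt_atTop.comp tendsto_natCast_atTop_atTop)
  have hq := tendstoInDistribution_prodMk hS.tendsto_joint (TendstoInProbConst.of_tendsto hr)
    fun n ↦ by fun_prop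
  have hΔ2 : 0 < Δ ^ 2 / 2 := by positivity
  have h0 := hq.continuous_comp (continuous_fixedDen Δ lam)
  -- At `1 / √n = 0` the denominator reduces to `Δ²`, so it falls below the truncation level `Δ² /
  -- 2` with vanishing probability.
  have e0 : (fixedDen Δ lam ∘ fun x : EuclideanSpace ℝ (Fin 2) ↦
      (((x, σC ^ 2 - σE ^ 2), σC ^ 2 - σE ^ 2), (0 : ℝ))) = fun _ ↦ Δ ^ 2 := by
    ext x
    simp [fixedDen, sq_nonneg]
  rw [e0] at h0
  have h1 := hq.continuous_comp (continuous_fixedMap hΔ lam)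
  have hbad := (hS.tendsto_vDiff.tendsto_measure_lt (half_lt_self hs)).add
    (tendsto_measure_lt_of_tendstoInDistribution h0 (b := Δ ^ 2 / 2) (by linarith))
  rw [add_zero] at hbad
  have h2 := tendstoInDistribution_of_tendsto_measure_ne h1 (aemeasurable_combined hS hp) (by
    refine tendsto_of_tendsto_of_tendsto_of_le_of_le' tendsto_const_nhds hbad
      (Eventually.of_forall fun _ ↦ zero_le) ?_
    filter_upwards [eventually_ge_atTop 1] with n hn
    refine (measure_mono fun ω hω ↦ ?_).trans (measure_union_le _ _)
    by_contra! hlt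
    simp only [Set.mem_union, Set.mem_ofPred_eq, not_or, not_lt] at hlt
    obtain ⟨hlt, hden⟩ := hlt
    refine hω ?_
    have hn0 : (0 : ℝ) < √(n : ℝ) := Real.sqrt_pos.2 (by exact_mod_cast hn)
    have hW : Δ + (√(n : ℝ))⁻¹ * (√(n : ℝ) * (S.bE n ω - βE n) - √(n : ℝ) * (S.bC n ω - β₀ n)) =
        S.bE n ω - S.bC n ω := by
      rw [hβ n]; field_simp; ring
    rw [sqrt_mul_combined_sub hp hn ((half_pos hs).trans_le hlt)]
    simp only [Function.comp_apply, fixedMap, fixedDen, Matrix.cons_val_zero,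
      Matrix.cons_val_one, hW] at hden ⊢
    rw [max_eq_left hden]
    generalize n * S.vDiff n ω = d at hden ⊢
    set D := max 0 ((S.bE n ω - S.bC n ω) ^ 2 - lam * (d * (√(n : ℝ))⁻¹ ^ 2)) +
      d * (√(n : ℝ))⁻¹ ^ 2 with hD
    have hD0 : 0 < D := hΔ2.trans_le hden
    -- The true denominator is `n D`: the correction to `bC` is of order `1 / √n` and disappears in
    -- the limit.
    have hden' : max 0 ((√(n : ℝ) * (S.bE n ω - S.bC n ω)) ^ 2 - lam * d) + d =
        √(n : ℝ) ^ 2 * D := by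
      rw [hD, mul_add, mul_max_of_nonneg _ _ (sq_nonneg _), mul_zero]
      congr 2
      · field_simp
      · field_simp
    rw [hden']
    field_simp)
  have hmp := measurePreserving_eval_multivariateGaussian (posSemidef_joint hS.variance_lt)
    (μ := 0) (i := 0)
  refine tendstoInDistribution_congr_law h2 h2.forall_aemeasurable aemeasurable_id
    (fun _ ↦ rfl) ?_
  have hmap : (jointLaw σC σE).map (fun x ↦ x 0) = gaussianReal 0 (σC ^ 2).toNNReal := hmp.map_eq
  rw [Measure.map_id, ← hmap]
  congr 1
  ext x
  simp [fixedMap]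

end

end PretestMSE

end

theorem proposition1 {Ω : ℕ → Type*} [∀ n, MeasurableSpace (Ω n)]
    (P : (n : ℕ) → Measure (Ω n)) [∀ n, IsProbabilityMeasure (P n)]
    (S : PretestMSE.Statistics Ω) (β₀ βE : ℕ → ℝ) (σC σE : ℝ)
    (hS : PretestMSE.Setup P S β₀ βE σC σE) :
    -- 1. fixed `β₀ ≠ β_E`
    (∀ b₀ bE : ℝ, b₀ ≠ bE → (∀ n, β₀ n = b₀) → (∀ n, βE n = bE) →
      ∀ lam : ℝ, 0 ≤ lam → ∀ p, PretestMSE.IsOptimalWeight P S lam p →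
        TendstoInDistribution
          (fun (n : ℕ) (ω : Ω n) ↦ √(n : ℝ) * (PretestMSE.combined S p n ω - β₀ n))
          atTop id P (gaussianReal 0 (σC ^ 2).toNNReal)) ∧
    -- 2. `β₀ = β_E`
    ((∀ n, β₀ n = βE n) →
      ∀ lam : ℝ, 0 ≤ lam → ∀ p, PretestMSE.IsOptimalWeight P S lam p →
        TendstoInDistribution
          (fun (n : ℕ) (ω : Ω n) ↦ √(n : ℝ) * (PretestMSE.combined S p n ω - β₀ n))
          atTop (PretestMSE.limitU σC σE lam) P (PretestMSE.lawVW σC σE 0)) ∧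
    (∀ lam : ℝ, 0 ≤ lam → ∫ x, PretestMSE.limitU σC σE lam x ∂(PretestMSE.lawVW σC σE 0) = 0) ∧
    StrictAntiOn
      (fun lam : ℝ ↦ Var[PretestMSE.limitU σC σE lam; PretestMSE.lawVW σC σE 0]) (Set.Ici 0) ∧
    Tendsto (fun lam : ℝ ↦ Var[PretestMSE.limitU σC σE lam; PretestMSE.lawVW σC σE 0])
      atTop (𝓝 (σE ^ 2)) ∧
    -- 3. local alternatives `β_E = β₀ + h / √n`
    (∀ h : ℝ, (∀ n : ℕ, 1 ≤ n → βE n = β₀ n + h / √(n : ℝ)) →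
      ∀ lam : ℝ, 0 ≤ lam → ∀ p, PretestMSE.IsOptimalWeight P S lam p →
        TendstoInDistribution
          (fun (n : ℕ) (ω : Ω n) ↦ √(n : ℝ) * (PretestMSE.combined S p n ω - β₀ n))
          atTop (PretestMSE.limitU σC σE lam) P (PretestMSE.lawVW σC σE h)) ∧
    -- the expectations and variances above and below are those of square-integrable variables
    (∀ h lam : ℝ, 0 ≤ lam → MemLp (PretestMSE.limitU σC σE lam) 2 (PretestMSE.lawVW σC σE h)) ∧
    -- maximal regret of `lam` relative to `0` exceeds its maximal gain; both maxima are attained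
    (∀ lam : ℝ, 0 < lam → ∃ maxRegret maxGain : ℝ,
      IsGreatest (Set.range fun h : ℝ ↦
        PretestMSE.risk σC σE h lam - PretestMSE.risk σC σE h 0) maxRegret ∧
      IsGreatest (Set.range fun h : ℝ ↦
        PretestMSE.risk σC σE h 0 - PretestMSE.risk σC σE h lam) maxGain ∧
      maxGain < maxRegret) := by
  have hσ := hS.variance_lt
  refine ⟨fun b₀ bE hne h₀ hE lam _ p hp ↦ ?_, fun heq lam _ p hp ↦ ?_,
    fun lam _ ↦ PretestMSE.integral_limitU hσ lam,
    (PretestMSE.strictAnti_variance_limitU hσ).strictAntiOn _,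
    PretestMSE.tendsto_variance_limitU hσ,
    fun h hβ lam _ p hp ↦ PretestMSE.tendsto_combined_local hS hp hβ,
    fun h lam _ ↦ PretestMSE.memLp_limitU hσ h lam,
    fun lam hlam ↦ PretestMSE.exists_max_regret_gt_max_gain hσ hlam⟩
  · exact PretestMSE.tendsto_combined_fixed hS hp (sub_ne_zero.2 hne.symm) fun n ↦ by
      rw [h₀, hE]; ring
  -- Equality of the parameters is the local alternative with `h = 0`.
  · exact PretestMSE.tendsto_combined_local hS hp fun n _ ↦ by rw [heq n, zero_div, add_zero]
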